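/- Let $M\subset\mathbb R^3$ be a compact embedded $C^\infty$ surface with (possibly empty) boundary $\partial M$, oriented by a continuous unit normal field $\mathbf N$, with area element $dA$ and position vector $\mathbf X$; $\partial M$ carries the induced orientation, i.e. its positive unit tangent $\mathbf X_s$ is the one for which $\mathbf N\times\mathbf X_s$ points into $M$. Put $d\mathbf X=\mathbf X_s\,ds$ and $d\mathbf N=\mathbf N_s\,ds$, where $s$ is arc length and $\mathbf N_s$ is the derivative of $\mathbf N$ in the direction $\mathbf X_s$. Let $\mathbf P,\mathbf Q$ be orthonormal principal directions on $M$ (not necessarily continuous) with $\mathbf P\times\mathbf Q=\mathbf N$, with corresponding principal curvatures $\kappa_1,\kappa_2$, so that $\mathbf N_p=-\kappa_1\mathbf P$ and $\mathbf N_q=-\kappa_2\mathbf Q$, where subscripts $p,q$ denote directional derivatives in the directions $\mathbf P,\mathbf Q$. Let $H=\tfrac12(\kappa_1+\kappa_2)$ and $K=\kappa_1\kappa_2$. Then for every vector field $\mathbf V$ that is $C^1$ on an open neighbourhood of $M$ in $\mathbb R^3$ (in particular, for every $C^1$ vector field on $\mathbb R^3$), $$\int_{\partial M}(\mathbf V\times\mathbf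 N)\cdot d\mathbf X=-\int_M\left(\mathbf V_p\cdot\mathbf P+\mathbf V_q\cdot\mathbf Q+2H\,\mathbf V\cdot\mathbf N\right)dA,$$ $$\int_{\partial M}(\mathbf V\times\mathbf N)\cdot d\mathbf N=\int_M\left(\kappa_2\,\mathbf V_p\cdot\mathbf P+\kappa_1\,\mathbf V_q\cdot\mathbf Q+2K\,\mathbf V\cdot\mathbf N\right)dA.$$ Moreover, the following vector identities hold: $$\int_{\partial M}\mathbf N\times d\mathbf X=-2\int_M H\,\mathbf N\,dA,\qquad \int_{\partial M}\mathbf N\times d\mathbf N=2\int_M K\,\mathbf N\,dA,$$ $$\int_{\partial M}\mathbf X\times(\mathbf N\times d\mathbf X)=-2\int_M H\,\mathbf X\times\mathbf N\,dA,\qquad \int_{\partial M}\mathbf X\times(\mathbf N\times d\mathbf N)=2\int_M K\,\mathbf X\times\mathbf N\,dA,$$ as well as Minkowski's formulas $$\int_{\partial M}\mathbf X\times\mathbf N\cdot d\mathbf X=-2\int_M(1+H\,\mathbf X\cdot\mathbf N)\,dA,\qquad \int_{\partial M}\mathbf X\times\mathbf N\cdot d\mathbf N=2\int_M(H+K\,\mathbf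 X\cdot\mathbf N)\,dA.$$ All of these integrals converge absolutely. -/

import Mathlib

open MeasureTheory Set
open scoped RealInnerProductSpace ContDiff

noncomputable section

/-- Euclidean three-space. -/
abbrev E3 : Type := EuclideanSpace ℝ (Fin 3)

/-- The cross product `a × b` on Euclidean three-space. -/
def cross (a b : E3) : E3 := WithLp.toLp 2 (crossProduct a.ofLp b.ofLp)

infixl:74 " ×ᵥ " => cross

/-- `Φ` is a smooth diffeomorphism between open subsets of `ℝ³` that carries the part of `M` in its
domain onto the part of the closed half-plane `{y | y 2 = 0, 0 ≤ y 1}` in its image. -/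
structure IsSliceChart (M : Set E3) (Φ : OpenPartialHomeomorph E3 E3) : Prop where
  contDiffOn : ContDiffOn ℝ ∞ Φ Φ.source
  contDiffOn_symm : ContDiffOn ℝ ∞ Φ.symm Φ.target
  mem_iff : ∀ x ∈ Φ.source, x ∈ M ↔ Φ x 2 = 0 ∧ 0 ≤ Φ x 1

/-- `M` is an embedded `C^∞` surface in `ℝ³`, with (possibly empty) boundary. -/
def IsSmoothSurface (M : Set E3) : Prop :=
  ∀ x ∈ M, ∃ Φ : OpenPartialHomeomorph E3 E3, IsSliceChart M Φ ∧ x ∈ Φ.source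

/-- The boundary `∂M`: the points of `M` that a slice chart sends to the edge of the half-plane. -/
def surfaceBoundary (M : Set E3) : Set E3 :=
  {x | x ∈ M ∧ ∃ Φ : OpenPartialHomeomorph E3 E3,
    IsSliceChart M Φ ∧ x ∈ Φ.source ∧ Φ x 1 = 0}

/-- `N` is a continuous unit normal vector field on `M`, i.e. an orientation of `M`. -/
structure IsUnitNormalField (M : Set E3) (N : E3 → E3) : Prop where
  continuousOn : ContinuousOn N M
  norm_eq_one : ∀ x ∈ M, ‖N x‖ = 1
  normal : ∀ x ∈ M, ∀ v ∈ tangentConeAt ℝ M x, ⟪N x, v⟫ = 0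

/-- The directional derivative at `x`, in the direction of a tangent vector `v` to `M`, of a map
`F` that matters only on `M`. (The derivative within `M` is determined on tangent vectors.) -/
def tangentialDeriv (M : Set E3) (F : E3 → E3) (x v : E3) : E3 := fderivWithin ℝ F M x v

/-- `t` is the unit tangent vector to `∂M` at `x` in the positive direction, the one for which
`N × t` points into `M`. -/
structure IsPositiveUnitTangent (M : Set E3) (N : E3 → E3) (x t : E3) : Prop where
  norm_eq_one : ‖t‖ = 1
  tangent : t ∈ tangentConeAt ℝ (surfaceBoundary M) x
  inward : N x ×ᵥ t ∈ posTangentConeAt M x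

/-- The positively oriented unit tangent `dX/ds` to `∂M`. -/
def boundaryTangent (M : Set E3) (N : E3 → E3) (x : E3) : E3 :=
  Classical.epsilon (IsPositiveUnitTangent M N x)

/-- The derivative `dN/ds` of the normal along the positively oriented boundary. -/
def boundaryNormalDeriv (M : Set E3) (N : E3 → E3) (x : E3) : E3 :=
  tangentialDeriv M N x (boundaryTangent M N x)

/-- `P` and `Q` are orthonormal principal directions on `M`, with `P × Q = N` and with principal
curvatures `κ₁` and `κ₂`: `N_p = -κ₁ P` and `N_q = -κ₂ Q`. No continuity is required. -/
structure IsPrincipalFrame (M : Set E3) (N P Q : E3 → E3) (κ₁ κ₂ : E3 → ℝ) : Prop where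
  norm_P : ∀ x ∈ M, ‖P x‖ = 1
  norm_Q : ∀ x ∈ M, ‖Q x‖ = 1
  orthogonal : ∀ x ∈ M, ⟪P x, Q x⟫ = 0
  oriented : ∀ x ∈ M, P x ×ᵥ Q x = N x
  deriv_P : ∀ x ∈ M, tangentialDeriv M N x (P x) = -(κ₁ x • P x)
  deriv_Q : ∀ x ∈ M, tangentialDeriv M N x (Q x) = -(κ₂ x • Q x)

/-- The mean curvature `H`. -/
def meanCurvature (κ₁ κ₂ : E3 → ℝ) (x : E3) : ℝ := (κ₁ x + κ₂ x) / 2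

/-- The Gaussian curvature `K`. -/
def gaussCurvature (κ₁ κ₂ : E3 → ℝ) (x : E3) : ℝ := κ₁ x * κ₂ x

/-- The integral of `f` over `M` against the surface area element `dA`. -/
def surfaceIntegral {F : Type*} [NormedAddCommGroup F] [NormedSpace ℝ F]
    (M : Set E3) (f : E3 → F) : F := ∫ x in M, f x ∂μHE[2]

/-- The integral of `f` over `∂M` against the arc length element `ds`. -/
def boundaryIntegral {F : Type*} [NormedAddCommGroup F] [NormedSpace ℝ F]
    (M : Set E3) (f : E3 → F) : F := ∫ x in surfaceBoundary M, f x ∂μHE[1]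

/-- Absolute convergence of the surface integral of `f` over `M`. -/
def SurfaceIntegrable {F : Type*} [NormedAddCommGroup F] (M : Set E3) (f : E3 → F) : Prop :=
  IntegrableOn f M μHE[2]

/-- Absolute convergence of the line integral of `f` over `∂M`. -/
def BoundaryIntegrable {F : Type*} [NormedAddCommGroup F] (M : Set E3) (f : E3 → F) : Prop :=
  IntegrableOn f (surfaceBoundary M) μHE[1]

end

/-!
The two identities are Stokes' theorem for the one-forms `⟪V × N, dX⟫` and `⟪V × N, dN⟫` on `M`.
Mathlib has neither integration of forms on a surface nor the area formula for Hausdorff measure, so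
the argument is made in coordinates.

* The area formula `integral_image_eq_integral_normDet_smul`: under an injective immersion, Hausdorff
  measure pulls back to Lebesgue measure with density the factor `LinearMap.normDet` by which the
  derivative scales volume. Compared with its derivative at a point, the immersion is near that
  point Lipschitz in both directions with constants close to one, so the formula holds up to a
  factor close to one for small sets, hence for all sets, hence exactly.
* Green's theorem `setIntegral_curlForm` on a half-plane, for the one-form `⟪T × n, dY⟫`. In its
  exterior derivative the second derivatives of `Y` cancel, which leaves the density `curlForm`.
* A patch (`IsPatch`) parametrizes a piece of `M` by a piece of the half-plane. In a patch `N` is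
  `σ` times the normal `n` of the parametrization `ψ`, with a constant sign `σ`; the derivative of
  `N` along `M` is `σ` times that of `n`; and the positive tangent of `∂M` is `σ ψ_u / ‖ψ_u‖`.
* The density is an alternating form on the tangent plane, so it can be evaluated on the principal
  frame instead of the coordinate frame. This gives the integrands of the theorem
  (`curlPair_param`, `curlPair_normal`), with no regularity required of the frame.

Thus the identities hold for fields supported in a patch (`IsPatch.fieldIdentities`), and a
partition of unity gives all fields (`fieldIdentities_of_contDiffOn`). The vector identities are the
scalar ones for the fields `e` and `x ↦ e × x`, for every vector `e`, and Minkowski's formulas are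
the ones for the position field.
-/

/-! ### The area formula for Hausdorff measure -/

section AreaFormula

open Filter Topology Module
open scoped ENNReal NNReal

/-- If `f` is `K`-Lipschitz with respect to the distances measured after applying `g`, then it
expands `d`-dimensional measure, compared with `g`, by at most `K ^ d`. -/
theorem euclideanHausdorffMeasure_image_le_of_edist_le {X Y Z : Type*} [EMetricSpace X]
    [EMetricSpace Y] [MeasurableSpace Y] [BorelSpace Y] [EMetricSpace Z] [MeasurableSpace Z]
    [BorelSpace Z] {f : X → Y} {g : X → Z} {s : Set X} {K : ℝ≥0}
    (h : ∀ x ∈ s, ∀ y ∈ s, edist (f x) (f y) ≤ K * edist (g x) (g y)) (d : ℕ) :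
    μHE[d] (f '' s) ≤ (K : ℝ≥0∞) ^ d * μHE[d] (g '' s) := by
  classical
  rcases s.eq_empty_or_nonempty with rfl | ⟨x₀, hx₀⟩
  · simp
  have : Nonempty X := ⟨x₀⟩
  -- `f` factors through `g` on `s` by a Lipschitz map
  set k : Z → Y := fun z => f (Function.invFunOn g s z)
  have hk : LipschitzOnWith K k (g '' s) := by
    intro a ha b hb
    have h1 := h _ (Function.invFunOn_mem ha) _ (Function.invFunOn_mem hb)
    rwa [Function.invFunOn_eq ha, Function.invFunOn_eq hb] at h1
  have himg : f '' s = k '' (g '' s) := by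
    rw [image_image]
    refine image_congr fun x hx => ?_
    have hgx : g x ∈ g '' s := mem_image_of_mem g hx
    have h1 := h _ hx _ (Function.invFunOn_mem hgx)
    rw [Function.invFunOn_eq hgx, edist_self, mul_zero, nonpos_iff_eq_zero, edist_eq_zero] at h1
    exact h1
  rw [himg]
  simp_rw [Measure.euclideanHausdorffMeasure_def, Measure.smul_apply]
  have h2 := hk.hausdorffMeasure_image_le (d := (d : ℝ)) (by positivity)
  rw [ENNReal.rpow_natCast] at h2
  rw [mul_smul_comm]
  exact smul_le_smul_of_nonneg_left h2 (by positivity)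

variable {U E : Type*} [NormedAddCommGroup U] [InnerProductSpace ℝ U] [FiniteDimensional ℝ U]
  [NormedAddCommGroup E] [InnerProductSpace ℝ E]

theorem continuous_normDet : Continuous fun L : U →L[ℝ] E => (L : U →ₗ[ℝ] E).normDet := by
  have h : (fun L : U →L[ℝ] E => (L : U →ₗ[ℝ] E).normDet) =
      fun L => √(Matrix.gram ℝ (fun i => L (stdOrthonormalBasis ℝ U i))).det := by
    funext L
    have := (L : U →ₗ[ℝ] E).normDet_sq_eq_det_gram (stdOrthonormalBasis ℝ U)
    rw [← Real.sqrt_sq (L : U →ₗ[ℝ] E).normDet_nonneg]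
    congr 1
  rw [h]
  refine Real.continuous_sqrt.comp (Continuous.matrix_det ?_)
  refine continuous_matrix fun i j => ?_
  simp only [Matrix.gram_apply]
  fun_prop

/-- Near a point where its derivative is injective, a strictly differentiable map distorts distances
by a factor close to one, compared with its derivative. -/
theorem HasStrictFDerivAt.eventually_dist_le {f : U → E} {f' : U →L[ℝ] E} {x : U}
    (hf : HasStrictFDerivAt f f' x) (hf' : Function.Injective f') {K : ℝ≥0} (hK : 1 < K) :
    ∃ W ∈ 𝓝 x, ∀ y ∈ W, ∀ z ∈ W, edist (f y) (f z) ≤ K * edist (f' y) (f' z) ∧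
      edist (f' y) (f' z) ≤ K * edist (f y) (f z) := by
  obtain ⟨c, hc0, hc⟩ := f'.exists_antilipschitzWith (LinearMap.ker_eq_bot.2 hf')
  have hK' : (1 : ℝ) < K := hK
  have hK0 : (0 : ℝ) < K := by linarith
  have hc0' : (0 : ℝ) < c := hc0
  -- the relative error `δ` satisfies both `1 + δ ≤ K` and `1 ≤ K (1 - δ)`
  set δ : ℝ := 1 - 1 / K with hδ
  have hδ0 : 0 < δ := by
    rw [hδ, sub_pos, div_lt_one hK0]; exact hK'
  have h1 : 1 + δ ≤ K := by
    have : 0 ≤ (K - 1) ^ 2 / (K : ℝ) := by positivity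
    have e : (K - 1) ^ 2 / (K : ℝ) = K - (1 + δ) := by rw [hδ]; field_simp; ring
    linarith
  have h2 : K * (1 - δ) = 1 := by rw [hδ]; field_simp; ring
  have hdef := hf.isLittleO.def (div_pos hδ0 hc0')
  rw [nhds_prod_eq] at hdef
  obtain ⟨W, hW, hWW⟩ := (Filter.mem_prod_same_iff).1 hdef
  refine ⟨W, hW, fun y hy z hz => ?_⟩
  have h3 : ‖f y - f z - f' (y - z)‖ ≤ δ / c * ‖y - z‖ := hWW (mk_mem_prod hy hz)
  have h4 : ‖y - z‖ ≤ c * ‖f' y - f' z‖ := by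
    have := hc.le_mul_dist y z
    rwa [dist_eq_norm, dist_eq_norm] at this
  have h5 : ‖f y - f z - f' (y - z)‖ ≤ δ * ‖f' (y - z)‖ := by
    refine h3.trans ?_
    rw [map_sub]
    calc δ / c * ‖y - z‖ ≤ δ / c * (c * ‖f' y - f' z‖) := by gcongr
      _ = δ * ‖f' y - f' z‖ := by field_simp
  have h6 : ‖f y - f z‖ ≤ K * ‖f' y - f' z‖ := by
    have := norm_add_le (f y - f z - f' (y - z)) (f' (y - z))
    rw [sub_add_cancel] at this
    rw [← map_sub]
    nlinarith [norm_nonneg (f' (y - z))]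
  have h7 : ‖f' y - f' z‖ ≤ K * ‖f y - f z‖ := by
    have := norm_sub_le (f y - f z) (f y - f z - f' (y - z))
    rw [sub_sub_cancel] at this
    rw [← map_sub]
    have h8 : (1 - δ) * ‖f' (y - z)‖ ≤ ‖f y - f z‖ := by linarith
    calc ‖f' (y - z)‖ = K * ((1 - δ) * ‖f' (y - z)‖) := by rw [← mul_assoc, h2, one_mul]
      _ ≤ K * ‖f y - f z‖ := by gcongr
  rw [← dist_eq_norm, ← dist_eq_norm] at h6 h7
  rw [edist_nndist, edist_nndist]
  exact ⟨mod_cast h6, mod_cast h7⟩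

theorem aemeasurable_normDet [MeasurableSpace U] [BorelSpace U] {f' : U → U →L[ℝ] E}
    {Ω s : Set U} (hcont : ContinuousOn f' Ω) (hs : s ⊆ Ω)
    (hsm : MeasurableSet s) :
    AEMeasurable (fun x => ((f' x : U →ₗ[ℝ] E).normDet).toNNReal) (volume.restrict s) := by
  refine ContinuousOn.aemeasurable ?_ hsm
  exact (continuous_real_toNNReal.comp continuous_normDet).comp_continuousOn (hcont.mono hs)

variable [MeasurableSpace U] [BorelSpace U] [MeasurableSpace E] [BorelSpace E]

theorem measurableEmbedding_domRestrict_of_hasStrictFDerivAt {f : U → E}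
    {f' : U → U →L[ℝ] E} {Ω : Set U} (hf : ∀ x ∈ Ω, HasStrictFDerivAt f (f' x) x)
    (hinj : InjOn f Ω) {s : Set U} (hs : s ⊆ Ω) (hsm : MeasurableSet s) :
    MeasurableEmbedding (s.domRestrict f) := by
  have hfc : ContinuousOn f s := fun x hx => (hf x (hs hx)).continuousAt.continuousWithinAt
  have : ProperSpace U := FiniteDimensional.proper ℝ U
  exact hfc.measurableEmbedding hsm (hinj.mono hs)

/-- Up to a factor close to one, the area formula holds for small sets. -/
theorem exists_nhds_euclideanHausdorffMeasure_image_le {f : U → E} {f' : U → U →L[ℝ] E} {x : U}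
    (hf : HasStrictFDerivAt f (f' x) x) (hcont : ContinuousAt f' x)
    (hinj : Function.Injective (f' x)) {K : ℝ≥0} (hK : 1 < K) :
    ∃ W ∈ 𝓝 x, ∀ s ⊆ W, MeasurableSet s →
      μHE[finrank ℝ U] (f '' s) ≤
        (K : ℝ≥0∞) ^ (finrank ℝ U + 1) *
          ∫⁻ y in s, ENNReal.ofReal (f' y : U →ₗ[ℝ] E).normDet ∧
      ∫⁻ y in s, ENNReal.ofReal (f' y : U →ₗ[ℝ] E).normDet ≤
        (K : ℝ≥0∞) ^ (finrank ℝ U + 1) * μHE[finrank ℝ U] (f '' s) := by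
  obtain ⟨W, hW, hWd⟩ := hf.eventually_dist_le hinj hK
  set J : U → ℝ := fun y => (f' y : U →ₗ[ℝ] E).normDet with hJ
  have hJc : ContinuousAt J x := continuous_normDet.continuousAt.comp hcont
  have hJ0 : 0 < J x := by
    refine lt_of_le_of_ne (LinearMap.normDet_nonneg _) (Ne.symm ?_)
    intro h
    exact LinearMap.normDet_eq_zero_iff_ker_ne_bot.1 h (LinearMap.ker_eq_bot.2 hinj)
  have hK' : (1 : ℝ) < K := hK
  have hK0 : (0 : ℝ) < K := by linarith
  have ev1 : ∀ᶠ y in 𝓝 x, J y < K * J x :=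
    hJc.eventually_lt_const (by nlinarith)
  have ev2 : ∀ᶠ y in 𝓝 x, J x / K < J y :=
    hJc.eventually_const_lt (by rw [div_lt_iff₀ hK0]; nlinarith)
  refine ⟨W ∩ {y | J y < K * J x ∧ J x / K < J y}, inter_mem hW (ev1.and ev2),
    fun s hs hsm => ?_⟩
  have hlin : μHE[finrank ℝ U] (f' x '' s) = ENNReal.ofReal (J x) * volume s :=
    (f' x : U →ₗ[ℝ] E).euclideanHausdorffMeasure_image_eq_normDet_mul_volume s
  have i1 : μHE[finrank ℝ U] (f '' s) ≤ (K : ℝ≥0∞) ^ finrank ℝ U * μHE[finrank ℝ U] (f' x '' s) :=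
    euclideanHausdorffMeasure_image_le_of_edist_le
      (fun y hy z hz => (hWd y (hs hy).1 z (hs hz).1).1) _
  have i2 : μHE[finrank ℝ U] (f' x '' s) ≤ (K : ℝ≥0∞) ^ finrank ℝ U * μHE[finrank ℝ U] (f '' s) :=
    euclideanHausdorffMeasure_image_le_of_edist_le
      (fun y hy z hz => (hWd y (hs hy).1 z (hs hz).1).2) _
  have j1 : ENNReal.ofReal (J x) * volume s ≤ K * ∫⁻ y in s, ENNReal.ofReal (J y) := by
    rw [← setLIntegral_const, ← lintegral_const_mul' _ _ ENNReal.coe_ne_top]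
    refine setLIntegral_mono' hsm fun y hy => ?_
    rw [← ENNReal.ofReal_coe_nnreal, ← ENNReal.ofReal_mul hK0.le]
    refine ENNReal.ofReal_le_ofReal ?_
    have := (hs hy).2.2
    rw [div_lt_iff₀ hK0] at this
    linarith
  have j2 : ∫⁻ y in s, ENNReal.ofReal (J y) ≤ K * (ENNReal.ofReal (J x) * volume s) := by
    rw [← mul_assoc, ← setLIntegral_const]
    refine setLIntegral_mono' hsm fun y hy => ?_
    rw [← ENNReal.ofReal_coe_nnreal, ← ENNReal.ofReal_mul hK0.le]
    exact ENNReal.ofReal_le_ofReal (hs hy).2.1.le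
  constructor
  · calc μHE[finrank ℝ U] (f '' s) ≤ (K : ℝ≥0∞) ^ finrank ℝ U * (ENNReal.ofReal (J x) * volume s) :=
          hlin ▸ i1
      _ ≤ (K : ℝ≥0∞) ^ finrank ℝ U * (K * ∫⁻ y in s, ENNReal.ofReal (J y)) := by gcongr
      _ = _ := by rw [pow_succ, mul_assoc]
  · calc ∫⁻ y in s, ENNReal.ofReal (J y) ≤ K * (ENNReal.ofReal (J x) * volume s) := j2
      _ ≤ K * ((K : ℝ≥0∞) ^ finrank ℝ U * μHE[finrank ℝ U] (f '' s)) := by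
          rw [← hlin]; gcongr
      _ = _ := by rw [pow_succ', mul_assoc]

/-- The area formula for injective immersions. -/
theorem euclideanHausdorffMeasure_image_eq_lintegral [CompleteSpace E]
    [SecondCountableTopology E] {f : U → E} {f' : U → U →L[ℝ] E} {Ω : Set U} (hΩ : IsOpen Ω)
    (hf : ∀ x ∈ Ω, HasStrictFDerivAt f (f' x) x) (hcont : ContinuousOn f' Ω)
    (hinj' : ∀ x ∈ Ω, Function.Injective (f' x)) (hinj : InjOn f Ω) {s : Set U} (hs : s ⊆ Ω)
    (hsm : MeasurableSet s) :
    μHE[finrank ℝ U] (f '' s) = ∫⁻ y in s, ENNReal.ofReal (f' y : U →ₗ[ℝ] E).normDet := by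
  have : ProperSpace U := FiniteDimensional.proper ℝ U
  have hfc : ContinuousOn f Ω := fun x hx => (hf x hx).continuousAt.continuousWithinAt
  -- the formula up to a factor, by countable additivity over small disjoint pieces
  have key : ∀ K : ℝ≥0, 1 < K →
      μHE[finrank ℝ U] (f '' s) ≤
        (K : ℝ≥0∞) ^ (finrank ℝ U + 1) *
          ∫⁻ y in s, ENNReal.ofReal (f' y : U →ₗ[ℝ] E).normDet ∧
      ∫⁻ y in s, ENNReal.ofReal (f' y : U →ₗ[ℝ] E).normDet ≤
        (K : ℝ≥0∞) ^ (finrank ℝ U + 1) * μHE[finrank ℝ U] (f '' s) := by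
    intro K hK
    choose! W hW hWs using fun x (hx : x ∈ Ω) =>
      exists_nhds_euclideanHausdorffMeasure_image_le (hf x hx)
        (hcont.continuousAt (hΩ.mem_nhds hx)) (hinj' x hx) hK
    obtain ⟨t, hts, htc, htu⟩ := TopologicalSpace.countable_cover_nhdsWithin
      (s := s) (f := fun x => interior (W x))
      (fun x hx => mem_nhdsWithin_of_mem_nhds (interior_mem_nhds.2 (hW x (hs hx))))
    have : Countable t := htc
    rcases isEmpty_or_nonempty t with he | hne
    · have : s = ∅ := by
        rw [← subset_empty_iff]
        refine htu.trans ?_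
        simp [isEmpty_coe_sort.1 he]
      subst this
      simp
    obtain ⟨e, he⟩ := exists_surjective_nat t
    set A : ℕ → Set U := disjointed fun n => interior (W (e n))
    have hAm : ∀ n, MeasurableSet (A n) :=
      fun n => MeasurableSet.disjointed (fun n => isOpen_interior.measurableSet) n
    have hAd : Pairwise (Function.onFun Disjoint A) := disjoint_disjointed _
    have hAu : s = ⋃ n, s ∩ A n := by
      rw [← inter_iUnion, iUnion_disjointed, eq_comm, inter_eq_left]
      refine htu.trans ?_
      intro y hy
      obtain ⟨x, hx, hy⟩ := mem_iUnion₂.1 hy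
      obtain ⟨n, hn⟩ := he ⟨x, hx⟩
      exact mem_iUnion.2 ⟨n, by rw [hn]; exact hy⟩
    have hdisj : Pairwise (Function.onFun Disjoint fun n => s ∩ A n) := fun i j hij =>
      (hAd hij).mono inter_subset_right inter_subset_right
    have hsAm : ∀ n, MeasurableSet (s ∩ A n) := fun n => hsm.inter (hAm n)
    have hloc := fun n => hWs (e n) (hs (hts (e n).2)) (s ∩ A n)
      (inter_subset_right.trans ((disjointed_subset _ n).trans interior_subset)) (hsAm n)
    have hsum1 : μHE[finrank ℝ U] (f '' s) = ∑' n, μHE[finrank ℝ U] (f '' (s ∩ A n)) := by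
      conv_lhs => rw [hAu, image_iUnion]
      refine measure_iUnion (fun i j hij => ?_) fun n => ?_
      · exact (hdisj hij).image (hinj) (inter_subset_left.trans hs) (inter_subset_left.trans hs)
      · exact (hsAm n).image_of_continuousOn_injOn
          (hfc.mono (inter_subset_left.trans hs)) (hinj.mono (inter_subset_left.trans hs))
    have hsum2 : ∫⁻ y in s, ENNReal.ofReal (f' y : U →ₗ[ℝ] E).normDet =
        ∑' n, ∫⁻ y in s ∩ A n, ENNReal.ofReal (f' y : U →ₗ[ℝ] E).normDet := by
      conv_lhs => rw [hAu]
      exact lintegral_iUnion hsAm hdisj _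
    rw [hsum1, hsum2, ← ENNReal.tsum_mul_left, ← ENNReal.tsum_mul_left]
    exact ⟨ENNReal.tsum_le_tsum fun n => (hloc n).1, ENNReal.tsum_le_tsum fun n => (hloc n).2⟩
  -- the factor tends to one
  have limit : ∀ a b : ℝ≥0∞, (∀ K : ℝ≥0, 1 < K → a ≤ (K : ℝ≥0∞) ^ (finrank ℝ U + 1) * b) →
      a ≤ b := by
    intro a b h
    have ht : Tendsto (fun K : ℝ≥0 => (K : ℝ≥0∞) ^ (finrank ℝ U + 1) * b) (𝓝[>] 1) (𝓝 b) := by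
      have h1 : Tendsto (fun K : ℝ≥0 => (K : ℝ≥0∞) ^ (finrank ℝ U + 1)) (𝓝[>] 1) (𝓝 1) := by
        have : Continuous fun K : ℝ≥0 => (K : ℝ≥0∞) ^ (finrank ℝ U + 1) :=
          (ENNReal.continuous_pow _).comp ENNReal.continuous_coe
        exact (this.tendsto' 1 1 (by simp)).mono_left nhdsWithin_le_nhds
      simpa using ENNReal.Tendsto.mul_const (b := b) h1 (Or.inl one_ne_zero)
    exact ge_of_tendsto ht (eventually_mem_nhdsWithin.mono fun K hK => h K hK)
  exact le_antisymm (limit _ _ fun K hK => (key K hK).1) (limit _ _ fun K hK => (key K hK).2)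

variable [CompleteSpace E] [SecondCountableTopology E] {f : U → E} {f' : U → U →L[ℝ] E}
  {Ω : Set U}

/-- The area formula as a change of variables: the Hausdorff measure on the image is the
push-forward of the measure with density `normDet` on the domain. -/
theorem map_withDensity_normDet_eq (hΩ : IsOpen Ω)
    (hf : ∀ x ∈ Ω, HasStrictFDerivAt f (f' x) x) (hcont : ContinuousOn f' Ω)
    (hinj' : ∀ x ∈ Ω, Function.Injective (f' x)) (hinj : InjOn f Ω) {s : Set U} (hs : s ⊆ Ω)
    (hsm : MeasurableSet s) :
    Measure.map (s.domRestrict f) (Measure.comap (↑)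
      (volume.withDensity fun x => ENNReal.ofReal (f' x : U →ₗ[ℝ] E).normDet)) =
      μHE[finrank ℝ U].restrict (f '' s) := by
  have hfc : ContinuousOn f s := fun x hx => (hf x (hs hx)).continuousAt.continuousWithinAt
  have hm : Measurable (s.domRestrict f) :=
    (continuousOn_iff_continuous_domRestrict.1 hfc).measurable
  refine Measure.ext fun t ht => ?_
  have hpre : (↑) '' (s.domRestrict f ⁻¹' t) = s ∩ f ⁻¹' t := by
    ext x; simp [and_comm]
  have hmt : MeasurableSet (s ∩ f ⁻¹' t) := by
    rw [← hpre]
    exact hsm.subtype_image (hm ht)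
  rw [Measure.map_apply hm ht, comap_subtype_coe_apply hsm, hpre, withDensity_apply _ hmt,
    Measure.restrict_apply ht,
    ← euclideanHausdorffMeasure_image_eq_lintegral hΩ hf hcont hinj' hinj
      (inter_subset_left.trans hs) hmt, image_inter_preimage, inter_comm]

variable {F : Type*} [NormedAddCommGroup F] [NormedSpace ℝ F]

/-- Integrability on the image of an injective immersion. -/
theorem integrableOn_image_iff_normDet_smul (hΩ : IsOpen Ω)
    (hf : ∀ x ∈ Ω, HasStrictFDerivAt f (f' x) x) (hcont : ContinuousOn f' Ω)
    (hinj' : ∀ x ∈ Ω, Function.Injective (f' x)) (hinj : InjOn f Ω) {s : Set U} (hs : s ⊆ Ω)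
    (hsm : MeasurableSet s) (g : E → F) :
    IntegrableOn g (f '' s) μHE[finrank ℝ U] ↔
      IntegrableOn (fun x => (f' x : U →ₗ[ℝ] E).normDet • g (f x)) s := by
  rw [IntegrableOn, ← map_withDensity_normDet_eq hΩ hf hcont hinj' hinj hs hsm,
    (measurableEmbedding_domRestrict_of_hasStrictFDerivAt hf hinj hs hsm).integrable_map_iff]
  simp only [Set.domRestrict_eq, ← Function.comp_assoc, ENNReal.ofReal]
  rw [← (MeasurableEmbedding.subtype_coe hsm).integrable_map_iff, map_comap_subtype_coe hsm,
    restrict_withDensity hsm, integrable_withDensity_iff_integrable_coe_smul₀]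
  · simp_rw [IntegrableOn, Real.coe_toNNReal _ (LinearMap.normDet_nonneg _), Function.comp_apply]
  · exact aemeasurable_normDet hcont hs hsm

/-- The area formula for Bochner integrals. -/
theorem integral_image_eq_integral_normDet_smul (hΩ : IsOpen Ω)
    (hf : ∀ x ∈ Ω, HasStrictFDerivAt f (f' x) x) (hcont : ContinuousOn f' Ω)
    (hinj' : ∀ x ∈ Ω, Function.Injective (f' x)) (hinj : InjOn f Ω) {s : Set U} (hs : s ⊆ Ω)
    (hsm : MeasurableSet s) (g : E → F) :
    ∫ y in f '' s, g y ∂μHE[finrank ℝ U] =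
      ∫ x in s, (f' x : U →ₗ[ℝ] E).normDet • g (f x) := by
  rw [← map_withDensity_normDet_eq hΩ hf hcont hinj' hinj hs hsm,
    (measurableEmbedding_domRestrict_of_hasStrictFDerivAt hf hinj hs hsm).integral_map]
  simp only [Set.domRestrict_apply, ← Function.comp_apply (f := g), ENNReal.ofReal]
  rw [← (MeasurableEmbedding.subtype_coe hsm).integral_map, map_comap_subtype_coe hsm,
    setIntegral_withDensity_eq_setIntegral_smul₀ (aemeasurable_normDet hcont hs hsm) _ hsm]
  congr with x
  rw [NNReal.smul_def, Real.coe_toNNReal _ (LinearMap.normDet_nonneg _)]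

end AreaFormula

/-! ### The cross product -/

section Cross

theorem cross_eq_coord (a b : E3) :
    a ×ᵥ b = !₂[a 1 * b 2 - a 2 * b 1, a 2 * b 0 - a 0 * b 2, a 0 * b 1 - a 1 * b 0] := by
  simp [cross, cross_apply]

theorem inner_eq_coord (a b : E3) : ⟪a, b⟫ = a 0 * b 0 + a 1 * b 1 + a 2 * b 2 := by
  simp [PiLp.inner_apply, Fin.sum_univ_three, mul_comm]

/-- The cross product as a continuous bilinear map. -/
noncomputable def crossCLM : E3 →L[ℝ] E3 →L[ℝ] E3 :=
  LinearMap.toContinuousLinearMap <| LinearMap.toContinuousLinearMap.toLinearMap ∘ₗ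
    LinearMap.mk₂ ℝ cross
      (fun a b c => by ext i; fin_cases i <;> simp [cross_eq_coord] <;> ring)
      (fun a b c => by ext i; fin_cases i <;> simp [cross_eq_coord] <;> ring)
      (fun a b c => by ext i; fin_cases i <;> simp [cross_eq_coord] <;> ring)
      (fun a b c => by ext i; fin_cases i <;> simp [cross_eq_coord] <;> ring)

@[simp] theorem crossCLM_apply (a b : E3) : crossCLM a b = a ×ᵥ b := rfl

theorem cross_add (a b c : E3) : a ×ᵥ (b + c) = a ×ᵥ b + a ×ᵥ c := (crossCLM a).map_add b c
theorem add_cross (a b c : E3) : (a + b) ×ᵥ c = a ×ᵥ c + b ×ᵥ c := by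
  simp [← crossCLM_apply]
theorem cross_smul (r : ℝ) (a b : E3) : a ×ᵥ (r • b) = r • (a ×ᵥ b) := (crossCLM a).map_smul r b
theorem smul_cross (r : ℝ) (a b : E3) : (r • a) ×ᵥ b = r • (a ×ᵥ b) := by
  simp [← crossCLM_apply]
theorem cross_neg_right (a b : E3) : a ×ᵥ (-b) = -(a ×ᵥ b) := (crossCLM a).map_neg b

theorem inner_cross_left (a b : E3) : ⟪a ×ᵥ b, a⟫ = 0 := by
  simp only [inner_eq_coord, cross_eq_coord]; simp; ring
theorem inner_cross_right (a b : E3) : ⟪a ×ᵥ b, b⟫ = 0 := by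
  simp only [inner_eq_coord, cross_eq_coord]; simp; ring

theorem inner_cross_rotate (a b c : E3) : ⟪a ×ᵥ b, c⟫ = ⟪a, b ×ᵥ c⟫ := by
  simp only [inner_eq_coord, cross_eq_coord]; simp; ring

/-- Lagrange's identity. -/
theorem inner_cross_cross (a b c d : E3) :
    ⟪a ×ᵥ b, c ×ᵥ d⟫ = ⟪a, c⟫ * ⟪b, d⟫ - ⟪a, d⟫ * ⟪b, c⟫ := by
  simp only [inner_eq_coord, cross_eq_coord]; simp; ring

theorem cross_cross_left (a b c : E3) : (a ×ᵥ b) ×ᵥ c = ⟪a, c⟫ • b - ⟪b, c⟫ • a := by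
  ext i; fin_cases i <;> simp [inner_eq_coord, cross_eq_coord] <;> ring

theorem cross_cross_right (a b c : E3) : a ×ᵥ (b ×ᵥ c) = ⟪a, c⟫ • b - ⟪a, b⟫ • c := by
  ext i; fin_cases i <;> simp [inner_eq_coord, cross_eq_coord] <;> ring

variable {G : Type*} [NormedAddCommGroup G] [NormedSpace ℝ G] {f g : G → E3}

theorem ContDiffAt.cross {m : WithTop ℕ∞} {x : G} (hf : ContDiffAt ℝ m f x)
    (hg : ContDiffAt ℝ m g x) : ContDiffAt ℝ m (fun y => f y ×ᵥ g y) x :=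
  (crossCLM.contDiff.contDiffAt.comp x hf).clm_apply hg

theorem HasFDerivAt.cross_apply {f' g' : G →L[ℝ] E3} {x : G} (hf : HasFDerivAt f f' x)
    (hg : HasFDerivAt g g' x) {h' : G →L[ℝ] E3}
    (hh : HasFDerivAt (fun y => f y ×ᵥ g y) h' x) (w : G) :
    h' w = f' w ×ᵥ g x + f x ×ᵥ g' w := by
  have h1 := (crossCLM.hasFDerivAt.comp x hf).clm_apply hg
  rw [hh.unique h1]
  simp [add_comm]

end Cross

/-! ### Green's theorem on the half-plane -/

section HalfPlane

open Filter Topology Complex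

theorem hasCompactSupport_comp_add_mul_I {a : ℂ → ℝ} (ha : HasCompactSupport a) (u : ℝ) :
    HasCompactSupport fun v : ℝ => a (u + v * I) := by
  refine ha.comp_isClosedEmbedding (g := fun v : ℝ => (u + v * I : ℂ))
    (Isometry.isClosedEmbedding ?_)
  exact Isometry.of_dist_eq fun x y => by
    rw [dist_add_left, dist_eq_norm, ← sub_mul, norm_mul, norm_I, mul_one, ← ofReal_sub,
      norm_real, dist_eq_norm]

theorem hasCompactSupport_comp_ofReal_add {a : ℂ → ℝ} (ha : HasCompactSupport a) (z : ℂ) :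
    HasCompactSupport fun u : ℝ => a (u + z) := by
  refine ha.comp_isClosedEmbedding (g := fun u : ℝ => (u + z : ℂ)) (Isometry.isClosedEmbedding ?_)
  exact Isometry.of_dist_eq fun x y => by
    rw [dist_add_right, dist_eq_norm, ← ofReal_sub, norm_real, dist_eq_norm]

theorem setIntegral_halfPlane_eq_integral_prod (g : ℂ → ℝ) :
    ∫ z in {z : ℂ | 0 ≤ z.im}, g z =
      ∫ p : ℝ × ℝ in univ ×ˢ Ioi (0 : ℝ), g (p.1 + p.2 * I) ∂(volume.prod volume) := by
  have h := volume_preserving_equiv_real_prod.symm.setIntegral_preimage_emb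
    measurableEquivRealProd.symm.measurableEmbedding g {z : ℂ | 0 ≤ z.im}
  rw [← h]
  have hs : measurableEquivRealProd.symm ⁻¹' {z : ℂ | 0 ≤ z.im} = univ ×ˢ Ici (0 : ℝ) := by
    ext p; simp [measurableEquivRealProd]
  rw [hs]
  have hf : (fun p : ℝ × ℝ => g (measurableEquivRealProd.symm p)) =
      fun p => g (p.1 + p.2 * I) := by
    funext p
    congr 1
    apply Complex.ext <;> simp [measurableEquivRealProd]
  rw [hf, Measure.volume_eq_prod]
  refine setIntegral_congr_set ?_
  exact Measure.set_prod_ae_eq (ae_eq_refl _) Ioi_ae_eq_Ici.symm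

/-- Green's theorem for compactly supported one-forms `a du + b dv` on the upper half-plane. -/
theorem setIntegral_halfPlane_fderiv_sub_fderiv {a b : ℂ → ℝ} (ha : ContDiff ℝ 1 a)
    (hb : ContDiff ℝ 1 b) (ha' : HasCompactSupport a) (hb' : HasCompactSupport b) :
    ∫ z in {z : ℂ | 0 ≤ z.im}, (fderiv ℝ b z 1 - fderiv ℝ a z I) = ∫ u : ℝ, a u := by
  have hca : Continuous fun z => fderiv ℝ a z I :=
    (ha.continuous_fderiv one_ne_zero).clm_apply continuous_const
  have hcb : Continuous fun z => fderiv ℝ b z 1 :=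
    (hb.continuous_fderiv one_ne_zero).clm_apply continuous_const
  have hsa : HasCompactSupport fun z => fderiv ℝ a z I :=
    (ha'.fderiv ℝ).comp_left (g := fun L : ℂ →L[ℝ] ℝ => L I) rfl
  have hsb : HasCompactSupport fun z => fderiv ℝ b z 1 :=
    (hb'.fderiv ℝ).comp_left (g := fun L : ℂ →L[ℝ] ℝ => L 1) rfl
  have hprod : ∀ g : ℂ → ℝ, Continuous g → HasCompactSupport g →
      Integrable (fun p : ℝ × ℝ => g (p.1 + p.2 * I)) (volume.prod volume) := by
    intro g hg hg'
    have h1 : Continuous fun p : ℝ × ℝ => g (p.1 + p.2 * I) := by fun_prop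
    refine h1.integrable_of_hasCompactSupport ?_
    have := hg'.comp_homeomorph equivRealProdCLM.toHomeomorph.symm
    have he : (fun p : ℝ × ℝ => g (p.1 + p.2 * I)) =
        g ∘ equivRealProdCLM.toHomeomorph.symm := by
      funext p
      refine congrArg g ?_
      apply Complex.ext <;> simp
    rwa [he]
  rw [integral_sub (hcb.integrable_of_hasCompactSupport hsb).integrableOn
    (hca.integrable_of_hasCompactSupport hsa).integrableOn]
  have hB : ∫ z in {z : ℂ | 0 ≤ z.im}, fderiv ℝ b z 1 = 0 := by
    rw [setIntegral_halfPlane_eq_integral_prod, ← Measure.prod_restrict, Measure.restrict_univ,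
      integral_prod_symm]
    swap
    · have h := (hprod _ hcb hsb).integrableOn (s := univ ×ˢ Ioi (0 : ℝ))
      rwa [IntegrableOn, ← Measure.prod_restrict, Measure.restrict_univ] at h
    refine integral_eq_zero_of_ae (Eventually.of_forall fun v => ?_)
    refine integral_eq_zero_of_hasDerivAt_of_integrable (f := fun u : ℝ => b (u + v * I))
      (fun u => ?_) ?_ ?_
    · have h1 : HasDerivAt (fun u : ℝ => (u + v * I : ℂ)) 1 u :=
        (ofRealCLM.hasDerivAt (x := u)).add_const _
      exact ((hb.differentiable one_ne_zero _).hasFDerivAt).comp_hasDerivAt u h1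
    · have h1 : Continuous fun u : ℝ => fderiv ℝ b (u + v * I) 1 :=
        hcb.comp (by fun_prop : Continuous fun u : ℝ => (u + v * I : ℂ))
      exact h1.integrable_of_hasCompactSupport (hasCompactSupport_comp_ofReal_add hsb _)
    · have h1 : Continuous fun u : ℝ => b (u + v * I) :=
        hb.continuous.comp (by fun_prop : Continuous fun u : ℝ => (u + v * I : ℂ))
      exact h1.integrable_of_hasCompactSupport (hasCompactSupport_comp_ofReal_add hb' _)
  have hA : ∫ z in {z : ℂ | 0 ≤ z.im}, fderiv ℝ a z I = -∫ u : ℝ, a u := by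
    rw [setIntegral_halfPlane_eq_integral_prod, ← Measure.prod_restrict, Measure.restrict_univ,
      integral_prod]
    swap
    · have h := (hprod _ hca hsa).integrableOn (s := univ ×ˢ Ioi (0 : ℝ))
      rwa [IntegrableOn, ← Measure.prod_restrict, Measure.restrict_univ] at h
    rw [← integral_neg]
    refine integral_congr_ae (Eventually.of_forall fun u => ?_)
    have hd : ∀ v : ℝ, HasDerivAt (fun v : ℝ => a (u + v * I)) (fderiv ℝ a (u + v * I) I) v := by
      intro v
      have h1 : HasDerivAt (fun v : ℝ => (u + v * I : ℂ)) I v := by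
        simpa using ((ofRealCLM.hasDerivAt (x := v)).mul_const I).const_add (u : ℂ)
      exact ((ha.differentiable one_ne_zero _).hasFDerivAt).comp_hasDerivAt v h1
    have h2 : ContDiff ℝ 1 fun v : ℝ => a (u + v * I) :=
      ha.comp (contDiff_const.add (ofRealCLM.contDiff.mul contDiff_const))
    have h3 := (hasCompactSupport_comp_add_mul_I ha' u).integral_Ioi_deriv_eq h2 0
    simp only [(hd _).deriv] at h3
    simpa using h3
  rw [hA, hB]
  ring

/-- The coefficient of the two-form `d⟪T × n, dY⟫`. -/
noncomputable def curlForm (T n Y : ℂ → E3) (z : ℂ) : ℝ :=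
  ⟪fderiv ℝ T z 1 ×ᵥ n z + T z ×ᵥ fderiv ℝ n z 1, fderiv ℝ Y z I⟫ -
    ⟪fderiv ℝ T z I ×ᵥ n z + T z ×ᵥ fderiv ℝ n z I, fderiv ℝ Y z 1⟫

/-- Green's theorem for the one-form `⟪T × n, dY⟫` on the part of an open set `Ω` in the upper
half-plane, where `T` vanishes away from a compact subset of `Ω`. -/
theorem setIntegral_curlForm {T n Y : ℂ → E3} {Ω K : Set ℂ} (hΩ : IsOpen Ω) (hK : IsCompact K)
    (hKΩ : K ⊆ Ω) (hT : ContDiffOn ℝ 1 T Ω) (hT0 : ∀ z ∈ Ω, z ∉ K → T z = 0)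
    (hn : ContDiffOn ℝ 1 n Ω) (hY : ContDiffOn ℝ 2 Y Ω) :
    IntegrableOn (curlForm T n Y) (Ω ∩ {z | 0 ≤ z.im}) ∧
    IntegrableOn (fun u : ℝ => ⟪T u ×ᵥ n u, fderiv ℝ Y u 1⟫) {u : ℝ | (u : ℂ) ∈ Ω} ∧
    ∫ z in Ω ∩ {z | 0 ≤ z.im}, curlForm T n Y z =
      ∫ u in {u : ℝ | (u : ℂ) ∈ Ω}, ⟪T u ×ᵥ n u, fderiv ℝ Y u 1⟫ := by
  classical
  set a : ℂ → ℂ → ℝ := fun w => Ω.indicator fun z => ⟪T z ×ᵥ n z, fderiv ℝ Y z w⟫ with ha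
  have hTd : ∀ z ∈ Ω, ContDiffAt ℝ 1 T z := fun z hz => hT.contDiffAt (hΩ.mem_nhds hz)
  have hnd : ∀ z ∈ Ω, ContDiffAt ℝ 1 n z := fun z hz => hn.contDiffAt (hΩ.mem_nhds hz)
  have hYd : ∀ z ∈ Ω, ContDiffAt ℝ 2 Y z := fun z hz => hY.contDiffAt (hΩ.mem_nhds hz)
  have hY' : ∀ z ∈ Ω, ContDiffAt ℝ 1 (fderiv ℝ Y) z :=
    fun z hz => (hYd z hz).fderiv_right (by norm_num)
  have heq : ∀ w, ∀ z ∈ Ω, a w =ᶠ[𝓝 z] fun z => ⟪T z ×ᵥ n z, fderiv ℝ Y z w⟫ := by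
    intro w z hz
    filter_upwards [hΩ.mem_nhds hz] with y hy
    rw [ha]; exact indicator_of_mem hy _
  have hzero : ∀ w, ∀ z ∉ K, a w z = 0 := by
    intro w z hz
    by_cases h : z ∈ Ω
    · rw [ha]; simp only [indicator_of_mem h]
      rw [hT0 z h hz, ← crossCLM_apply]; simp
    · rw [ha]; exact indicator_of_notMem h _
  have hzero' : ∀ w, ∀ z ∉ K, a w =ᶠ[𝓝 z] fun _ => 0 := fun w z hz =>
    Filter.mem_of_superset (hK.isClosed.isOpen_compl.mem_nhds hz) fun y hy => hzero w y hy
  have hcs : ∀ w, HasCompactSupport (a w) := fun w => HasCompactSupport.intro hK (hzero w)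
  -- `a w` is the form on the vector `w`; it is extended by zero across the boundary of `Ω`
  have hC : ∀ w, ContDiff ℝ 1 (a w) := by
    intro w
    rw [contDiff_iff_contDiffAt]
    intro z
    by_cases h : z ∈ Ω
    · refine ContDiffAt.congr_of_eventuallyEq ?_ (heq w z h)
      exact ((hTd z h).cross (hnd z h)).inner ℝ ((hY' z h).clm_apply contDiffAt_const)
    · exact contDiffAt_const.congr_of_eventuallyEq (hzero' w z fun hz => h (hKΩ hz))
  have hfd : ∀ w v, ∀ z ∈ Ω, fderiv ℝ (a w) z v =
      ⟪fderiv ℝ T z v ×ᵥ n z + T z ×ᵥ fderiv ℝ n z v, fderiv ℝ Y z w⟫ +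
        ⟪T z ×ᵥ n z, fderiv ℝ (fderiv ℝ Y) z v w⟫ := by
    intro w v z hz
    rw [(heq w z hz).fderiv_eq]
    have h1 := ((hTd z hz).cross (hnd z hz)).differentiableAt one_ne_zero
    have h2 := (hY' z hz).differentiableAt one_ne_zero
    have h3 : HasFDerivAt (fun z => fderiv ℝ Y z w)
        ((fderiv ℝ (fderiv ℝ Y) z).flip w) z := by
      simpa using h2.hasFDerivAt.clm_apply (hasFDerivAt_const w z)
    have h4 := (h1.hasFDerivAt.inner ℝ h3).fderiv
    rw [h4]
    have h5 := ((hTd z hz).differentiableAt one_ne_zero).hasFDerivAt.cross_apply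
      ((hnd z hz).differentiableAt one_ne_zero).hasFDerivAt h1.hasFDerivAt v
    simp [h5, add_comm]
  have hcurl : ∀ z ∈ Ω, curlForm T n Y z = fderiv ℝ (a I) z 1 - fderiv ℝ (a 1) z I := by
    intro z hz
    have hsymm := (hYd z hz).isSymmSndFDerivAt (by simp)
    rw [hfd _ _ z hz, hfd _ _ z hz, hsymm 1 I, curlForm]
    ring
  have hcont : ∀ w v, Continuous fun z => fderiv ℝ (a w) z v := fun w v =>
    ((hC w).continuous_fderiv one_ne_zero).clm_apply continuous_const
  have hcs' : ∀ w v, HasCompactSupport fun z => fderiv ℝ (a w) z v := fun w v =>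
    ((hcs w).fderiv ℝ).comp_left (g := fun L : ℂ →L[ℝ] ℝ => L v) rfl
  have hint : Integrable fun z => fderiv ℝ (a I) z 1 - fderiv ℝ (a 1) z I :=
    ((hcont _ _).integrable_of_hasCompactSupport (hcs' _ _)).sub
      ((hcont _ _).integrable_of_hasCompactSupport (hcs' _ _))
  have hHm : MeasurableSet {z : ℂ | 0 ≤ z.im} := measurableSet_le measurable_const measurable_im
  have hm : MeasurableSet (Ω ∩ {z : ℂ | 0 ≤ z.im}) := hΩ.measurableSet.inter hHm
  have hm' : MeasurableSet {u : ℝ | (u : ℂ) ∈ Ω} :=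
    (hΩ.preimage continuous_ofReal).measurableSet
  have hbd : ∀ u ∈ {u : ℝ | (u : ℂ) ∈ Ω}, a 1 u = ⟪T u ×ᵥ n u, fderiv ℝ Y u 1⟫ :=
    fun u hu => indicator_of_mem (s := Ω) hu _
  have hbint : Integrable fun u : ℝ => a 1 u := by
    have h1 : Continuous fun u : ℝ => a 1 u := (hC 1).continuous.comp continuous_ofReal
    refine h1.integrable_of_hasCompactSupport ?_
    simpa using hasCompactSupport_comp_ofReal_add (hcs 1) 0
  refine ⟨?_, ?_, ?_⟩
  · exact (hint.integrableOn (s := Ω ∩ {z : ℂ | 0 ≤ z.im})).congr_fun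
      (fun z hz => (hcurl z hz.1).symm) hm
  · exact hbint.integrableOn.congr_fun hbd hm'
  · have h1 := setIntegral_halfPlane_fderiv_sub_fderiv (hC 1) (hC I) (hcs 1) (hcs I)
    rw [setIntegral_congr_fun hm fun z hz => hcurl z hz.1, ← setIntegral_congr_fun hm' hbd,
      setIntegral_eq_integral_of_forall_compl_eq_zero
        (s := {u : ℝ | (u : ℂ) ∈ Ω}) (f := fun u : ℝ => a 1 u), ← h1]
    · refine (setIntegral_eq_of_subset_of_forall_sdiff_eq_zero hHm inter_subset_right ?_).symm
      intro z hz
      have hzK : z ∉ K := fun h => hz.2 ⟨hKΩ h, hz.1⟩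
      rw [(hzero' I z hzK).fderiv_eq, (hzero' 1 z hzK).fderiv_eq]
      simp
    · intro u hu
      exact indicator_of_notMem (s := Ω) hu _

end HalfPlane

/-! ### Local parametrizations of a surface with boundary -/

section Patch

open Filter Topology Complex

/-- The closed upper half-plane. -/
def upperHalf : Set ℂ := {z | 0 ≤ z.im}

theorem measurableSet_upperHalf : MeasurableSet upperHalf :=
  measurableSet_le measurable_const measurable_im

theorem convex_upperHalf : Convex ℝ upperHalf := convex_halfSpace_im_ge 0

theorem uniqueDiffOn_upperHalf : UniqueDiffOn ℝ upperHalf := by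
  refine uniqueDiffOn_convex convex_upperHalf ⟨I, ?_⟩
  refine mem_interior.2 ⟨{z | 0 < z.im}, fun z hz => le_of_lt (mem_ofPred.1 hz), ?_, by simp⟩
  exact isOpen_lt continuous_const continuous_im

/-- A smooth parametrization `ψ` of the part of `M` in the open set `W` by the part of the convex
open set `Ω` in the closed upper half-plane. Both `ψ`, on all of `Ω`, and its left inverse `π`, on
all of `W`, are smooth, so that derivatives at the edge of the half-plane are ordinary ones. -/
structure IsPatch (M W : Set E3) (Ω : Set ℂ) (ψ : ℂ → E3) (π : E3 → ℂ) : Prop where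
  isOpen_target : IsOpen W
  isOpen_domain : IsOpen Ω
  convex_domain : Convex ℝ Ω
  contDiffOn_param : ContDiffOn ℝ ∞ ψ Ω
  contDiffOn_coord : ContDiffOn ℝ ∞ π W
  mapsTo_param : MapsTo ψ Ω W
  leftInv : ∀ z ∈ Ω, π (ψ z) = z
  mem_iff : ∀ z ∈ Ω, ψ z ∈ M ↔ z ∈ upperHalf
  mem_boundary_iff : ∀ z ∈ Ω, ψ z ∈ surfaceBoundary M ↔ z.im = 0
  mapsTo_coord : ∀ x ∈ M ∩ W, π x ∈ Ω
  rightInv : ∀ x ∈ M ∩ W, ψ (π x) = x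
  isCompact_preimage : ∀ C ⊆ W, IsCompact C → IsCompact (Ω ∩ ψ ⁻¹' C)

/-- The derivative of a left inverse is a left inverse of the derivative. -/
theorem HasFDerivAt.apply_apply_of_leftInverse {X Y : Type*} [NormedAddCommGroup X]
    [NormedSpace ℝ X] [NormedAddCommGroup Y] [NormedSpace ℝ Y] {f : X → Y} {g : Y → X} {x : X}
    {f' : X →L[ℝ] Y} {g' : Y →L[ℝ] X} (hf : HasFDerivAt f f' x) (hg : HasFDerivAt g g' (f x))
    (h : ∀ᶠ y in 𝓝 x, g (f y) = y) (v : X) : g' (f' v) = v := by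
  have h1 : HasFDerivAt (fun y => y) (g'.comp f') x :=
    (hg.comp x hf).congr_of_eventuallyEq (h.mono fun y hy => hy.symm)
  exact congrArg (fun L : X →L[ℝ] X => L v) (h1.unique (hasFDerivAt_id x))

/-- The inclusion of the `uv`-plane into space. -/
noncomputable def planeIncl : ℂ →L[ℝ] E3 :=
  LinearMap.toContinuousLinearMap
    { toFun := fun z => !₂[z.re, z.im, 0]
      map_add' := fun z w => by ext i; fin_cases i <;> simp
      map_smul' := fun r z => by ext i; fin_cases i <;> simp }

theorem planeIncl_apply (z : ℂ) : planeIncl z = !₂[z.re, z.im, 0] := rfl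

/-- The projection of space to the `uv`-plane. -/
noncomputable def planeProj : E3 →L[ℝ] ℂ :=
  LinearMap.toContinuousLinearMap
    { toFun := fun x => ⟨x 0, x 1⟩
      map_add' := fun z w => by apply Complex.ext <;> simp
      map_smul' := fun r z => by apply Complex.ext <;> simp }

theorem planeProj_apply (x : E3) : planeProj x = ⟨x 0, x 1⟩ := rfl

theorem planeProj_planeIncl (z : ℂ) : planeProj (planeIncl z) = z := by
  apply Complex.ext <;> simp [planeProj_apply, planeIncl_apply]

theorem planeIncl_planeProj {x : E3} (h : x 2 = 0) : planeIncl (planeProj x) = x := by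
  ext i; fin_cases i <;> simp [planeProj_apply, planeIncl_apply, h]

/-- A slice chart cannot send to the edge of the half-plane a point around which `M` is parametrized
by an open set: there the second coordinate of the chart would be critical, and the derivative
would have rank at most one. -/
theorem IsSliceChart.apply_one_ne_zero {M : Set E3} {Φ : OpenPartialHomeomorph E3 E3}
    (hΦ : IsSliceChart M Φ) {ψ : ℂ → E3} {ψ' : ℂ →L[ℝ] E3} {z : ℂ} (hψ : HasFDerivAt ψ ψ' z)
    (hψ' : Function.Injective ψ') (hM : ∀ᶠ w in 𝓝 z, ψ w ∈ M) (hz : ψ z ∈ Φ.source) :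
    Φ (ψ z) 1 ≠ 0 := by
  intro h0
  have hΦd : HasFDerivAt Φ (fderiv ℝ Φ (ψ z)) (ψ z) :=
    ((hΦ.contDiffOn.contDiffAt (Φ.open_source.mem_nhds hz)).differentiableAt (by simp)).hasFDerivAt
  have hΦs : HasFDerivAt Φ.symm (fderiv ℝ Φ.symm (Φ (ψ z))) (Φ (ψ z)) :=
    ((hΦ.contDiffOn_symm.contDiffAt (Φ.open_target.mem_nhds (Φ.map_source hz))).differentiableAt
      (by simp)).hasFDerivAt
  have hinv := hΦd.apply_apply_of_leftInverse hΦs (Φ.eventually_left_inverse hz)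
  set L := (fderiv ℝ Φ (ψ z)).comp ψ' with hL
  have hcomp : HasFDerivAt (fun w => Φ (ψ w)) L z := hΦd.comp z hψ
  have hLinj : Function.Injective L := (Function.LeftInverse.injective hinv).comp hψ'
  have hmem : ∀ᶠ w in 𝓝 z, Φ (ψ w) 2 = 0 ∧ 0 ≤ Φ (ψ w) 1 := by
    filter_upwards [hM, hψ.continuousAt.preimage_mem_nhds (Φ.open_source.mem_nhds hz)] with w h1 h2
    exact (hΦ.mem_iff _ h2).1 h1
  have hc : ∀ i : Fin 3, HasFDerivAt (fun w => Φ (ψ w) i)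
      ((EuclideanSpace.proj i : E3 →L[ℝ] ℝ).comp L) z := fun i =>
    ((EuclideanSpace.proj i : E3 →L[ℝ] ℝ).hasFDerivAt).comp z hcomp
  have h1 : ∀ w, L w 1 = 0 := by
    intro w
    have hmin : IsLocalMin (fun w => Φ (ψ w) 1) z := hmem.mono fun w hw => h0.trans_le hw.2
    exact congrArg (fun A : ℂ →L[ℝ] ℝ => A w) (hmin.hasFDerivAt_eq_zero (hc 1))
  have h2 : ∀ w, L w 2 = 0 := by
    intro w
    have h3 : HasFDerivAt (fun w => Φ (ψ w) 2) (0 : ℂ →L[ℝ] ℝ) z :=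
      (hasFDerivAt_const (0 : ℝ) z).congr_of_eventuallyEq (hmem.mono fun w hw => hw.1)
    exact congrArg (fun A : ℂ →L[ℝ] ℝ => A w) ((hc 2).unique h3)
  -- all values of `L` lie on the first coordinate axis, so `L 1` and `L I` are linearly dependent
  have h4 : L ((L I 0) • (1 : ℂ) - (L 1 0) • I) = 0 := by
    rw [map_sub, map_smul, map_smul]
    ext i; fin_cases i
    · simp; ring
    · simp [h1]
    · simp [h2]
  have h5 := hLinj (h4.trans (map_zero L).symm)
  have h6 : L 1 0 = 0 := by simpa using congrArg Complex.im h5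
  have h7 : L 1 = 0 := by
    ext i; fin_cases i
    · simpa using h6
    · simp [h1]
    · simp [h2]
  exact one_ne_zero (hLinj (h7.trans (map_zero L).symm))

/-- A slice chart restricted to the inverse image of a convex open set gives a patch. -/
theorem IsSliceChart.isPatch {M : Set E3} {Φ : OpenPartialHomeomorph E3 E3}
    (hΦ : IsSliceChart M Φ) {B : Set E3} (hB : IsOpen B) (hBc : Convex ℝ B)
    (hBt : B ⊆ Φ.target) :
    IsPatch M (Φ.source ∩ Φ ⁻¹' B) (planeIncl ⁻¹' B) (fun z => Φ.symm (planeIncl z))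
      (fun y => planeProj (Φ y)) := by
  have hW : IsOpen (Φ.source ∩ Φ ⁻¹' B) := Φ.isOpen_inter_preimage hB
  have hΩ : IsOpen (planeIncl ⁻¹' B) := hB.preimage planeIncl.continuous
  have hψc : ContDiffOn ℝ ∞ (fun z => Φ.symm (planeIncl z)) (planeIncl ⁻¹' B) :=
    hΦ.contDiffOn_symm.comp planeIncl.contDiff.contDiffOn fun z hz => hBt hz
  have hπc : ContDiffOn ℝ ∞ (fun y => planeProj (Φ y)) (Φ.source ∩ Φ ⁻¹' B) :=
    planeProj.contDiff.comp_contDiffOn (hΦ.contDiffOn.mono inter_subset_left)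
  have hΦψ : ∀ z ∈ planeIncl ⁻¹' B, Φ (Φ.symm (planeIncl z)) = planeIncl z :=
    fun z hz => Φ.right_inv (hBt hz)
  have hψs : ∀ z ∈ planeIncl ⁻¹' B, Φ.symm (planeIncl z) ∈ Φ.source :=
    fun z hz => Φ.map_target (hBt hz)
  have hψW : MapsTo (fun z => Φ.symm (planeIncl z)) (planeIncl ⁻¹' B) (Φ.source ∩ Φ ⁻¹' B) :=
    fun z hz => ⟨hψs z hz, by rw [mem_preimage, hΦψ z hz]; exact hz⟩
  have hleft : ∀ z ∈ planeIncl ⁻¹' B, planeProj (Φ (Φ.symm (planeIncl z))) = z := fun z hz => by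
    rw [hΦψ z hz, planeProj_planeIncl]
  have hmem : ∀ z ∈ planeIncl ⁻¹' B, (Φ.symm (planeIncl z) ∈ M ↔ z ∈ upperHalf) := by
    intro z hz
    rw [hΦ.mem_iff _ (hψs z hz), hΦψ z hz]
    simp [planeIncl_apply, upperHalf]
  have hflat : ∀ y ∈ M ∩ (Φ.source ∩ Φ ⁻¹' B), planeIncl (planeProj (Φ y)) = Φ y :=
    fun y hy => planeIncl_planeProj ((hΦ.mem_iff y hy.2.1).1 hy.1).1
  refine
    { isOpen_target := hW
      isOpen_domain := hΩ
      convex_domain := hBc.linear_preimage (planeIncl : ℂ →ₗ[ℝ] E3)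
      contDiffOn_param := hψc
      contDiffOn_coord := hπc
      mapsTo_param := hψW
      leftInv := hleft
      mem_iff := hmem
      mem_boundary_iff := fun z hz => ⟨fun hb => ?_, fun hb => ?_⟩
      mapsTo_coord := fun y hy => ?_
      rightInv := fun y hy => ?_
      isCompact_preimage := fun C hC hCc => ?_ }
  · obtain ⟨hzM, Φ', hΦ', hzs, hz0⟩ := hb
    by_contra hne
    have hpos : 0 < z.im := lt_of_le_of_ne ((hmem z hz).1 hzM) (Ne.symm hne)
    have hd := ((hψc.contDiffAt (hΩ.mem_nhds hz)).differentiableAt (by simp)).hasFDerivAt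
    have hd' := ((hπc.contDiffAt (hW.mem_nhds (hψW hz))).differentiableAt (by simp)).hasFDerivAt
    have hinv := hd.apply_apply_of_leftInverse hd'
      (Filter.mem_of_superset (hΩ.mem_nhds hz) hleft)
    refine hΦ'.apply_one_ne_zero hd (Function.LeftInverse.injective hinv) ?_ hzs hz0
    filter_upwards [hΩ.mem_nhds hz,
      (isOpen_lt continuous_const continuous_im).mem_nhds hpos] with w hw hw'
    exact (hmem w hw).2 (le_of_lt hw')
  · refine ⟨(hmem z hz).2 hb.ge, Φ, hΦ, hψs z hz, ?_⟩
    rw [hΦψ z hz]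
    simpa [planeIncl_apply] using hb
  · rw [mem_preimage, hflat y hy]
    exact hy.2.2
  · rw [hflat y hy, Φ.left_inv hy.2.1]
  · have hemb : Topology.IsClosedEmbedding planeIncl :=
      LinearMap.isClosedEmbedding_of_injective (f := (planeIncl : ℂ →ₗ[ℝ] E3))
        (LinearMap.ker_eq_bot.2 (Function.LeftInverse.injective planeProj_planeIncl))
    have hΦC : IsCompact (Φ '' C) :=
      hCc.image_of_continuousOn (Φ.continuousOn.mono fun y hy => (hC hy).1)
    have heq : planeIncl ⁻¹' B ∩ (fun z => Φ.symm (planeIncl z)) ⁻¹' C =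
        planeIncl ⁻¹' (Φ '' C) := by
      ext z
      constructor
      · rintro ⟨hz, hzC⟩
        exact ⟨_, hzC, hΦψ z hz⟩
      · rintro ⟨y, hy, hyz⟩
        refine ⟨?_, ?_⟩
        · rw [mem_preimage, ← hyz]; exact (hC hy).2
        · rw [mem_preimage, ← hyz, Φ.left_inv (hC hy).1]; exact hy
    rw [heq]
    exact hemb.isCompact_preimage hΦC

/-- Every point of a surface has arbitrarily small patches around it. -/
theorem IsSmoothSurface.exists_isPatch {M : Set E3} (hS : IsSmoothSurface M) {x : E3} (hx : x ∈ M)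
    {U : Set E3} (hU : IsOpen U) (hxU : x ∈ U) :
    ∃ (W : Set E3) (Ω : Set ℂ) (ψ : ℂ → E3) (π : E3 → ℂ), IsPatch M W Ω ψ π ∧ x ∈ W ∧ W ⊆ U := by
  obtain ⟨Φ, hΦ, hxΦ⟩ := hS x hx
  have hO : IsOpen (Φ.target ∩ Φ.symm ⁻¹' U) := Φ.symm.isOpen_inter_preimage hU
  have hxO : Φ x ∈ Φ.target ∩ Φ.symm ⁻¹' U :=
    ⟨Φ.map_source hxΦ, by rw [mem_preimage, Φ.left_inv hxΦ]; exact hxU⟩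
  obtain ⟨B, hBo, hBc, hB, hxB⟩ : ∃ B : Set E3, IsOpen B ∧ Convex ℝ B ∧
      B ⊆ Φ.target ∩ Φ.symm ⁻¹' U ∧ Φ x ∈ B := by
    obtain ⟨r, hr, hB⟩ := Metric.isOpen_iff.1 hO (Φ x) hxO
    exact ⟨Metric.ball (Φ x) r, Metric.isOpen_ball, convex_ball _ _, hB, Metric.mem_ball_self hr⟩
  refine ⟨_, _, _, _, hΦ.isPatch hBo hBc fun y hy => (hB hy).1, ⟨hxΦ, hxB⟩, ?_⟩
  rintro y ⟨hy, hyB⟩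
  have h1 : Φ.symm (Φ y) ∈ U := (hB hyB).2
  rwa [Φ.left_inv hy] at h1

/-- The image of a positive tangent cone under the derivative of a map is contained in the positive
tangent cone of the image. -/
theorem HasFDerivWithinAt.mapsTo_posTangentConeAt {X Y : Type*} [NormedAddCommGroup X]
    [NormedSpace ℝ X] [NormedAddCommGroup Y] [NormedSpace ℝ Y] {f : X → Y} {f' : X →L[ℝ] Y}
    {s : Set X} {x : X} (h : HasFDerivWithinAt f f' s x) :
    MapsTo f' (posTangentConeAt s x) (posTangentConeAt (f '' s) (f x)) := by
  intro y hy
  rcases exists_fun_of_mem_tangentConeAt hy with ⟨ι, l, hl, c, d, hd₀, hds, hcd⟩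
  apply mem_tangentConeAt_of_seq l c (fun n ↦ f (x + d n) - f x)
  · rw [tendsto_sub_nhds_zero_iff]
    refine h.continuousWithinAt.tendsto.comp <| tendsto_nhdsWithin_iff.mpr ⟨?_, hds⟩
    simpa using tendsto_const_nhds.add hd₀
  · exact hds.mono fun n hn ↦ ⟨x + d n, hn, by simp⟩
  · exact h.lim (c := fun n => (c n : ℝ)) hd₀ hds hcd

namespace IsPatch

variable {M W : Set E3} {Ω : Set ℂ} {ψ : ℂ → E3} {π : E3 → ℂ}

theorem contDiffAt_param (h : IsPatch M W Ω ψ π) {z : ℂ} (hz : z ∈ Ω) : ContDiffAt ℝ ∞ ψ z :=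
  h.contDiffOn_param.contDiffAt (h.isOpen_domain.mem_nhds hz)

theorem hasFDerivAt_param (h : IsPatch M W Ω ψ π) {z : ℂ} (hz : z ∈ Ω) :
    HasFDerivAt ψ (fderiv ℝ ψ z) z :=
  ((h.contDiffAt_param hz).differentiableAt (by simp)).hasFDerivAt

theorem hasFDerivAt_coord (h : IsPatch M W Ω ψ π) {x : E3} (hx : x ∈ W) :
    HasFDerivAt π (fderiv ℝ π x) x :=
  ((h.contDiffOn_coord.contDiffAt (h.isOpen_target.mem_nhds hx)).differentiableAt
    (by simp)).hasFDerivAt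

theorem fderiv_coord_fderiv_param (h : IsPatch M W Ω ψ π) {z : ℂ} (hz : z ∈ Ω) (w : ℂ) :
    fderiv ℝ π (ψ z) (fderiv ℝ ψ z w) = w :=
  (h.hasFDerivAt_param hz).apply_apply_of_leftInverse (h.hasFDerivAt_coord (h.mapsTo_param hz))
    (Filter.mem_of_superset (h.isOpen_domain.mem_nhds hz) h.leftInv) w

theorem injective_fderiv (h : IsPatch M W Ω ψ π) {z : ℂ} (hz : z ∈ Ω) :
    Function.Injective (fderiv ℝ ψ z) :=
  Function.LeftInverse.injective (h.fderiv_coord_fderiv_param hz)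

theorem injOn_param (h : IsPatch M W Ω ψ π) : InjOn ψ Ω := fun z hz w hw hzw => by
  rw [← h.leftInv z hz, hzw, h.leftInv w hw]

theorem image_upperHalf (h : IsPatch M W Ω ψ π) : ψ '' (Ω ∩ upperHalf) = M ∩ W := by
  ext x
  constructor
  · rintro ⟨z, hz, rfl⟩
    exact ⟨(h.mem_iff z hz.1).2 hz.2, h.mapsTo_param hz.1⟩
  · intro hx
    refine ⟨π x, ⟨h.mapsTo_coord x hx, ?_⟩, h.rightInv x hx⟩
    rw [← h.mem_iff _ (h.mapsTo_coord x hx), h.rightInv x hx]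
    exact hx.1

theorem image_real (h : IsPatch M W Ω ψ π) :
    (fun u : ℝ => ψ u) '' {u : ℝ | (u : ℂ) ∈ Ω} = surfaceBoundary M ∩ W := by
  ext x
  constructor
  · rintro ⟨u, hu, rfl⟩
    exact ⟨(h.mem_boundary_iff _ hu).2 (ofReal_im u), h.mapsTo_param hu⟩
  · intro hx
    have hxM : x ∈ M ∩ W := ⟨hx.1.1, hx.2⟩
    have him : (π x).im = 0 := by
      rw [← h.mem_boundary_iff _ (h.mapsTo_coord x hxM), h.rightInv x hxM]
      exact hx.1
    have hre : ((π x).re : ℂ) = π x := Complex.ext (by simp) (by simp [him])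
    refine ⟨(π x).re, ?_, ?_⟩
    · change ((π x).re : ℂ) ∈ Ω
      rw [hre]; exact h.mapsTo_coord x hxM
    · change ψ ((π x).re : ℂ) = x
      rw [hre]; exact h.rightInv x hxM

/-- Tangent vectors of `M` are images of vectors of the plane. -/
theorem fderiv_param_of_mem_tangentConeAt (h : IsPatch M W Ω ψ π) {z : ℂ} (hz : z ∈ Ω) {v : E3}
    (hv : v ∈ tangentConeAt ℝ M (ψ z)) : fderiv ℝ ψ z (fderiv ℝ π (ψ z) v) = v := by
  have hW := h.isOpen_target.mem_nhds (h.mapsTo_param hz)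
  rw [← tangentConeAt_inter_nhds hW] at hv
  have h1 : HasFDerivAt (fun x => ψ (π x)) ((fderiv ℝ ψ z).comp (fderiv ℝ π (ψ z))) (ψ z) := by
    refine HasFDerivAt.comp (ψ z) (g := ψ) ?_ (h.hasFDerivAt_coord (h.mapsTo_param hz))
    rw [h.leftInv z hz]
    exact h.hasFDerivAt_param hz
  have h2 : HasFDerivWithinAt (fun x => ψ (π x)) (ContinuousLinearMap.id ℝ E3) (M ∩ W) (ψ z) :=
    (hasFDerivWithinAt_id (ψ z) (M ∩ W)).congr (fun x hx => h.rightInv x hx)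
      (by simp [h.leftInv z hz])
  exact h1.hasFDerivWithinAt.unique_on h2 hv

theorem mapsTo_tangentConeAt (h : IsPatch M W Ω ψ π) {z : ℂ} (hz : z ∈ Ω) :
    MapsTo (fderiv ℝ ψ z) (tangentConeAt ℝ (Ω ∩ upperHalf) z) (tangentConeAt ℝ M (ψ z)) := by
  refine (h.hasFDerivAt_param hz).hasFDerivWithinAt.mapsTo_tangent_cone.mono_right ?_
  rw [h.image_upperHalf]
  exact tangentConeAt_mono inter_subset_left

theorem uniqueDiffWithinAt (h : IsPatch M W Ω ψ π) {z : ℂ} (hz : z ∈ Ω) (hz' : z ∈ upperHalf) :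
    UniqueDiffWithinAt ℝ (Ω ∩ upperHalf) z := by
  rw [inter_comm]
  exact (uniqueDiffOn_upperHalf.inter h.isOpen_domain) z ⟨hz', hz⟩

end IsPatch

end Patch

/-! ### The normal of a parametrization -/

section ParamNormal

open Filter Topology Complex

/-- The vector `ψ_u × ψ_v` of a parametrization `ψ` of a surface. -/
noncomputable def areaVector (ψ : ℂ → E3) (z : ℂ) : E3 := fderiv ℝ ψ z 1 ×ᵥ fderiv ℝ ψ z I

/-- The unit normal `ψ_u × ψ_v / ‖ψ_u × ψ_v‖` of a parametrization `ψ` of a surface. -/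
noncomputable def paramNormal (ψ : ℂ → E3) (z : ℂ) : E3 := ‖areaVector ψ z‖⁻¹ • areaVector ψ z

theorem map_eq_re_smul_add_im_smul {Y : Type*} [NormedAddCommGroup Y] [NormedSpace ℝ Y]
    (L : ℂ →L[ℝ] Y) (w : ℂ) : L w = w.re • L 1 + w.im • L I := by
  rw [← map_smul, ← map_smul, ← map_add]
  congr 1
  apply Complex.ext <;> simp

theorem im_smul_I_sub_smul_one (r s : ℝ) : (r • I - s • (1 : ℂ)).im = r := by simp

theorem cross_map_one_map_I_ne_zero {L : ℂ →L[ℝ] E3} (hL : Function.Injective L) :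
    L 1 ×ᵥ L I ≠ 0 := by
  intro h
  have h1 : L (⟪L 1, L 1⟫ • I - ⟪L I, L 1⟫ • (1 : ℂ)) = 0 := by
    rw [map_sub, map_smul, map_smul, ← cross_cross_left, h, ← crossCLM_apply]
    simp
  have h2 := hL (h1.trans (map_zero L).symm)
  have h3 : ⟪L 1, L 1⟫ = 0 := by
    rw [← im_smul_I_sub_smul_one ⟪L 1, L 1⟫ ⟪L I, L 1⟫, h2, zero_im]
  exact one_ne_zero (hL ((inner_self_eq_zero.1 h3).trans (map_zero L).symm))

theorem cross_map_map (L : ℂ →L[ℝ] E3) (p q : ℂ) :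
    L p ×ᵥ L q = (p.re * q.im - p.im * q.re) • (L 1 ×ᵥ L I) := by
  rw [map_eq_re_smul_add_im_smul L p, map_eq_re_smul_add_im_smul L q]
  ext i; fin_cases i <;> simp [cross_eq_coord] <;> ring

/-- The factor by which a linear map of the plane to space scales area. -/
theorem normDet_eq_norm_cross (L : ℂ →L[ℝ] E3) : (L : ℂ →ₗ[ℝ] E3).normDet = ‖L 1 ×ᵥ L I‖ := by
  rw [← sq_eq_sq₀ (LinearMap.normDet_nonneg _) (norm_nonneg _)]
  have h := (L : ℂ →ₗ[ℝ] E3).normDet_sq_eq_det_gram Complex.orthonormalBasisOneI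
  rw [Matrix.det_fin_two] at h
  simp only [Matrix.gram_apply, Complex.coe_orthonormalBasisOneI] at h
  rw [← real_inner_self_eq_norm_sq, inner_cross_cross]
  simpa using h

/-- The factor by which a linear map of the line to space scales length. -/
theorem normDet_eq_norm_map_one (L : ℝ →L[ℝ] E3) : (L : ℝ →ₗ[ℝ] E3).normDet = ‖L 1‖ := by
  rw [← sq_eq_sq₀ (LinearMap.normDet_nonneg _) (norm_nonneg _)]
  have h := (L : ℝ →ₗ[ℝ] E3).normDet_sq_eq_det_gram (OrthonormalBasis.singleton (Fin 1) ℝ)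
  rw [Matrix.det_unique] at h
  simp only [Matrix.gram_apply, OrthonormalBasis.singleton_apply] at h
  rw [← real_inner_self_eq_norm_sq]
  simpa using h

/-- A vector orthogonal to `a` and `b` is a multiple of `a × b`. -/
theorem eq_inner_smul_of_inner_eq_zero {a b x n : E3} {c : ℝ} (hn : n = c • (a ×ᵥ b))
    (hn1 : ‖n‖ = 1) (ha : ⟪x, a⟫ = 0) (hb : ⟪x, b⟫ = 0) : x = ⟪x, n⟫ • n := by
  have h1 : x ×ᵥ n = 0 := by
    rw [hn, cross_smul, cross_cross_right, ha, hb]; simp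
  have h2 := cross_cross_left x n n
  rw [h1, real_inner_self_eq_norm_sq, hn1, ← crossCLM_apply] at h2
  simp only [map_zero, _root_.zero_apply, one_pow, one_smul] at h2
  exact (sub_eq_zero.1 h2.symm).symm

namespace IsPatch

variable {M W : Set E3} {Ω : Set ℂ} {ψ : ℂ → E3} {π : E3 → ℂ}

theorem areaVector_ne_zero (h : IsPatch M W Ω ψ π) {z : ℂ} (hz : z ∈ Ω) : areaVector ψ z ≠ 0 :=
  cross_map_one_map_I_ne_zero (h.injective_fderiv hz)

theorem norm_areaVector_pos (h : IsPatch M W Ω ψ π) {z : ℂ} (hz : z ∈ Ω) :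
    0 < ‖areaVector ψ z‖ := norm_pos_iff.2 (h.areaVector_ne_zero hz)

theorem norm_paramNormal (h : IsPatch M W Ω ψ π) {z : ℂ} (hz : z ∈ Ω) : ‖paramNormal ψ z‖ = 1 := by
  rw [paramNormal, norm_smul, norm_inv, norm_norm, inv_mul_cancel₀ (h.norm_areaVector_pos hz).ne']

theorem areaVector_eq_smul_paramNormal (h : IsPatch M W Ω ψ π) {z : ℂ} (hz : z ∈ Ω) :
    areaVector ψ z = ‖areaVector ψ z‖ • paramNormal ψ z := by
  rw [paramNormal, smul_smul, mul_inv_cancel₀ (h.norm_areaVector_pos hz).ne', one_smul]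

theorem contDiffOn_paramNormal (h : IsPatch M W Ω ψ π) : ContDiffOn ℝ ∞ (paramNormal ψ) Ω := by
  intro z hz
  have h1 : ContDiffAt ℝ ∞ (fderiv ℝ ψ) z := (h.contDiffAt_param hz).fderiv_right (by simp)
  have h2 : ContDiffAt ℝ ∞ (areaVector ψ) z :=
    (h1.clm_apply contDiffAt_const).cross (h1.clm_apply contDiffAt_const)
  exact (((h2.norm ℝ (h.areaVector_ne_zero hz)).inv (h.norm_areaVector_pos hz).ne').smul
    h2).contDiffWithinAt

theorem hasFDerivAt_paramNormal (h : IsPatch M W Ω ψ π) {z : ℂ} (hz : z ∈ Ω) :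
    HasFDerivAt (paramNormal ψ) (fderiv ℝ (paramNormal ψ) z) z :=
  ((h.contDiffOn_paramNormal.contDiffAt (h.isOpen_domain.mem_nhds hz)).differentiableAt
    (by simp)).hasFDerivAt

theorem inner_normal_fderiv (h : IsPatch M W Ω ψ π) {N : E3 → E3} (hN : IsUnitNormalField M N)
    {z : ℂ} (hz : z ∈ Ω) (hz' : z ∈ upperHalf) (w : ℂ) : ⟪N (ψ z), fderiv ℝ ψ z w⟫ = 0 := by
  have h1 : (innerSL ℝ (N (ψ z))).comp (fderiv ℝ ψ z) = 0 :=
    ContinuousLinearMap.ext_on (h.uniqueDiffWithinAt hz hz').dense_tangentConeAt fun v hv =>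
      hN.normal _ ((h.mem_iff z hz).2 hz') _ (h.mapsTo_tangentConeAt hz hv)
  exact congrArg (fun L : ℂ →L[ℝ] ℝ => L w) h1

/-- On a patch the orientation of `M` is, up to a constant sign, the one of the parametrization. -/
theorem exists_sign (h : IsPatch M W Ω ψ π) {N : E3 → E3} (hN : IsUnitNormalField M N) :
    ∃ σ : ℝ, σ * σ = 1 ∧ ∀ z ∈ Ω ∩ upperHalf, N (ψ z) = σ • paramNormal ψ z := by
  have hproj : ∀ z ∈ Ω ∩ upperHalf,
      N (ψ z) = ⟪N (ψ z), paramNormal ψ z⟫ • paramNormal ψ z := fun z hz =>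
    eq_inner_smul_of_inner_eq_zero rfl (h.norm_paramNormal hz.1)
      (h.inner_normal_fderiv hN hz.1 hz.2 1) (h.inner_normal_fderiv hN hz.1 hz.2 I)
  set s : ℂ → ℝ := fun z => ⟪N (ψ z), paramNormal ψ z⟫ with hs
  have hcont : ContinuousOn s (Ω ∩ upperHalf) := by
    refine ContinuousOn.inner ?_ (h.contDiffOn_paramNormal.continuousOn.mono inter_subset_left)
    exact hN.continuousOn.comp (h.contDiffOn_param.continuousOn.mono inter_subset_left)
      fun z hz => (h.mem_iff z hz.1).2 hz.2
  have hsq : EqOn (s ^ 2) 1 (Ω ∩ upperHalf) := by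
    intro z hz
    have h1 := hN.norm_eq_one _ ((h.mem_iff z hz.1).2 hz.2)
    rw [hproj z hz, norm_smul, h.norm_paramNormal hz.1, mul_one, Real.norm_eq_abs] at h1
    change s z ^ 2 = 1
    rw [← sq_abs, h1, one_pow]
  have hconn : IsPreconnected (Ω ∩ upperHalf) :=
    (h.convex_domain.inter convex_upperHalf).isPreconnected
  rcases hconn.eq_one_or_eq_neg_one_of_sq_eq hcont hsq with h1 | h1
  · exact ⟨1, by norm_num, fun z hz => by rw [hproj z hz]; congr 1; exact h1 hz⟩
  · exact ⟨-1, by norm_num, fun z hz => by rw [hproj z hz]; congr 1; exact h1 hz⟩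

variable {N : E3 → E3} {σ : ℝ}

/-- The derivative of the normal of `M` in a chart. -/
theorem tangentialDeriv_normal (h : IsPatch M W Ω ψ π)
    (hσ : ∀ z ∈ Ω ∩ upperHalf, N (ψ z) = σ • paramNormal ψ z) {z : ℂ} (hz : z ∈ Ω)
    (hz' : z ∈ upperHalf) (w : ℂ) :
    tangentialDeriv M N (ψ z) (fderiv ℝ ψ z w) = σ • fderiv ℝ (paramNormal ψ) z w := by
  have hzW := h.mapsTo_param hz
  have hext : DifferentiableWithinAt ℝ N (M ∩ W) (ψ z) := by
    have h1 : DifferentiableAt ℝ (fun x => σ • paramNormal ψ (π x)) (ψ z) := by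
      refine DifferentiableAt.const_smul ?_ σ
      refine DifferentiableAt.comp (ψ z) (g := paramNormal ψ) ?_
        (h.hasFDerivAt_coord hzW).differentiableAt
      rw [h.leftInv z hz]
      exact (h.hasFDerivAt_paramNormal hz).differentiableAt
    refine h1.differentiableWithinAt.congr (fun x hx => ?_) ?_
    · have hx' : π x ∈ Ω ∩ upperHalf := by
        refine ⟨h.mapsTo_coord x hx, ?_⟩
        rw [← h.mem_iff _ (h.mapsTo_coord x hx), h.rightInv x hx]
        exact hx.1
      rw [← hσ _ hx', h.rightInv x hx]
    · rw [h.leftInv z hz]; exact hσ z ⟨hz, hz'⟩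
  have hd : DifferentiableWithinAt ℝ N M (ψ z) :=
    (differentiableWithinAt_inter (h.isOpen_target.mem_nhds hzW)).1 hext
  have h2 : HasFDerivWithinAt (fun y => N (ψ y)) ((fderivWithin ℝ N M (ψ z)).comp (fderiv ℝ ψ z))
      (Ω ∩ upperHalf) z :=
    hd.hasFDerivWithinAt.comp z (h.hasFDerivAt_param hz).hasFDerivWithinAt
      fun y hy => (h.mem_iff y hy.1).2 hy.2
  have h3 : HasFDerivWithinAt (fun y => N (ψ y)) (σ • fderiv ℝ (paramNormal ψ) z)
      (Ω ∩ upperHalf) z :=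
    ((h.hasFDerivAt_paramNormal hz).const_smul σ).hasFDerivWithinAt.congr hσ (hσ z ⟨hz, hz'⟩)
  exact congrArg (fun L : ℂ →L[ℝ] E3 => L w) ((h.uniqueDiffWithinAt hz hz').eq h2 h3)

theorem mem_tangentConeAt_boundary (h : IsPatch M W Ω ψ π) {u : ℝ} (hu : (u : ℂ) ∈ Ω) (r : ℝ) :
    r • fderiv ℝ ψ u 1 ∈ tangentConeAt ℝ (surfaceBoundary M) (ψ u) := by
  have hO : IsOpen {u : ℝ | (u : ℂ) ∈ Ω} := h.isOpen_domain.preimage continuous_ofReal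
  have h1 : HasFDerivAt (fun u : ℝ => ψ u) ((fderiv ℝ ψ u).comp ofRealCLM) u :=
    (h.hasFDerivAt_param hu).comp u ofRealCLM.hasFDerivAt
  have h2 : r ∈ tangentConeAt ℝ {u : ℝ | (u : ℂ) ∈ Ω} u := by
    rw [tangentConeAt_of_mem_nhds (hO.mem_nhds hu)]; trivial
  have h3 := h1.hasFDerivWithinAt.mapsTo_tangent_cone h2
  rw [h.image_real] at h3
  have h4 : ((fderiv ℝ ψ u).comp ofRealCLM) r = r • fderiv ℝ ψ u 1 := by
    rw [ContinuousLinearMap.comp_apply, ← map_smul]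
    congr 1
    simp
  rw [h4] at h3
  exact tangentConeAt_mono inter_subset_left h3

theorem eq_smul_of_mem_tangentConeAt_boundary (h : IsPatch M W Ω ψ π) {u : ℝ} (hu : (u : ℂ) ∈ Ω)
    {t : E3} (ht : t ∈ tangentConeAt ℝ (surfaceBoundary M) (ψ u)) :
    t = (fderiv ℝ π (ψ u) t).re • fderiv ℝ ψ u 1 := by
  have hW := h.mapsTo_param hu
  have h1 := h.fderiv_param_of_mem_tangentConeAt hu (tangentConeAt_mono (fun x hx => hx.1) ht)
  have him : (fderiv ℝ π (ψ u) t).im = 0 := by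
    rw [← tangentConeAt_inter_nhds (h.isOpen_target.mem_nhds hW)] at ht
    have h2 : HasFDerivWithinAt (fun x => (π x).im) (imCLM.comp (fderiv ℝ π (ψ u)))
        (surfaceBoundary M ∩ W) (ψ u) :=
      (imCLM.hasFDerivAt.comp (ψ u) (h.hasFDerivAt_coord hW)).hasFDerivWithinAt
    have h3 : HasFDerivWithinAt (fun x => (π x).im) (0 : E3 →L[ℝ] ℝ)
        (surfaceBoundary M ∩ W) (ψ u) := by
      refine (hasFDerivWithinAt_const (0 : ℝ) _ _).congr (fun x hx => ?_) ?_
      · have hx' : x ∈ M ∩ W := ⟨hx.1.1, hx.2⟩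
        rw [← h.mem_boundary_iff _ (h.mapsTo_coord x hx'), h.rightInv x hx']
        exact hx.1
      · rw [h.leftInv _ hu, ofReal_im]
    exact h2.unique_on h3 ht
  conv_lhs => rw [← h1, map_eq_re_smul_add_im_smul, him, zero_smul, add_zero]

theorem fderiv_mem_posTangentConeAt (h : IsPatch M W Ω ψ π) {u : ℝ} (hu : (u : ℂ) ∈ Ω) {w : ℂ}
    (hw : 0 ≤ w.im) : fderiv ℝ ψ u w ∈ posTangentConeAt M (ψ u) := by
  have h1 : w ∈ posTangentConeAt (Ω ∩ upperHalf) (u : ℂ) := by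
    refine mem_posTangentConeAt_of_frequently_mem (Eventually.frequently ?_)
    have h2 : Tendsto (fun t : ℝ => (u : ℂ) + t • w) (𝓝[>] 0) (𝓝 u) :=
      (Continuous.tendsto' (by fun_prop) 0 (u : ℂ) (by simp)).mono_left nhdsWithin_le_nhds
    filter_upwards [h2.eventually_mem (h.isOpen_domain.mem_nhds hu), self_mem_nhdsWithin]
      with t ht ht0
    refine ⟨ht, ?_⟩
    have : 0 ≤ t * w.im := mul_nonneg (le_of_lt ht0) hw
    simpa [upperHalf] using this
  have h3 := (h.hasFDerivAt_param hu).hasFDerivWithinAt.mapsTo_posTangentConeAt h1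
  rw [h.image_upperHalf] at h3
  exact tangentConeAt_mono inter_subset_left h3

theorem im_fderiv_nonneg (h : IsPatch M W Ω ψ π) {u : ℝ} (hu : (u : ℂ) ∈ Ω) {v : E3}
    (hv : v ∈ posTangentConeAt M (ψ u)) : 0 ≤ (fderiv ℝ π (ψ u) v).im := by
  have hW := h.mapsTo_param hu
  rw [posTangentConeAt, ← tangentConeAt_inter_nhds (h.isOpen_target.mem_nhds hW)] at hv
  have h2 : HasFDerivWithinAt (fun x => (π x).im) (imCLM.comp (fderiv ℝ π (ψ u)))
      (M ∩ W) (ψ u) :=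
    (imCLM.hasFDerivAt.comp (ψ u) (h.hasFDerivAt_coord hW)).hasFDerivWithinAt
  have hmin : IsLocalMinOn (fun x => (π x).im) (M ∩ W) (ψ u) := by
    filter_upwards [self_mem_nhdsWithin] with x hx
    rw [h.leftInv _ hu, ofReal_im]
    have := (h.mem_iff _ (h.mapsTo_coord x hx)).1 (by rw [h.rightInv x hx]; exact hx.1)
    exact this
  exact hmin.hasFDerivWithinAt_nonneg h2 hv

theorem norm_fderiv_one_pos (h : IsPatch M W Ω ψ π) {z : ℂ} (hz : z ∈ Ω) :
    0 < ‖fderiv ℝ ψ z 1‖ :=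
  norm_pos_iff.2 fun h0 => one_ne_zero (h.injective_fderiv hz (h0.trans (map_zero _).symm))

/-- The rotated tangent `n × ψ_u` points to the side of the boundary where `v` increases. -/
theorem im_fderiv_cross (h : IsPatch M W Ω ψ π) {z : ℂ} (hz : z ∈ Ω) :
    ∃ w : ℂ, 0 < w.im ∧ paramNormal ψ z ×ᵥ fderiv ℝ ψ z 1 = fderiv ℝ ψ z w := by
  set a := fderiv ℝ ψ z 1 with ha
  set b := fderiv ℝ ψ z I with hb
  have hJ := h.norm_areaVector_pos hz
  refine ⟨‖areaVector ψ z‖⁻¹ • (⟪a, a⟫ • I - ⟪b, a⟫ • (1 : ℂ)), ?_, ?_⟩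
  · have h1 : 0 < ⟪a, a⟫ := by
      rw [real_inner_self_eq_norm_sq]; exact pow_pos (h.norm_fderiv_one_pos hz) 2
    rw [smul_im, im_smul_I_sub_smul_one, smul_eq_mul]
    exact mul_pos (inv_pos.2 hJ) h1
  · rw [map_smul, map_sub, map_smul, map_smul, ← ha, ← hb, ← cross_cross_left, paramNormal,
      smul_cross, areaVector]

/-- The positive unit tangent in a patch. -/
theorem boundaryTangent_eq (h : IsPatch M W Ω ψ π) (hσ1 : σ * σ = 1)
    (hσ : ∀ z ∈ Ω ∩ upperHalf, N (ψ z) = σ • paramNormal ψ z) {u : ℝ} (hu : (u : ℂ) ∈ Ω) :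
    boundaryTangent M N (ψ u) = (σ * ‖fderiv ℝ ψ u 1‖⁻¹) • fderiv ℝ ψ u 1 := by
  set a := fderiv ℝ ψ u 1 with ha
  have ha0 : 0 < ‖a‖ := h.norm_fderiv_one_pos hu
  have hσabs : |σ| = 1 := by
    have : |σ| * |σ| = 1 := by rw [← abs_mul, hσ1, abs_one]
    nlinarith [abs_nonneg σ]
  have hu' : (u : ℂ) ∈ Ω ∩ upperHalf := ⟨hu, (ofReal_im u).ge⟩
  obtain ⟨w, hw, hw'⟩ := h.im_fderiv_cross hu
  have hrot : ∀ r : ℝ, N (ψ u) ×ᵥ (r • a) = fderiv ℝ ψ u ((σ * r) • w) := by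
    intro r
    rw [hσ _ hu', cross_smul, smul_cross, hw', map_smul, smul_smul, mul_comm]
  have hex : IsPositiveUnitTangent M N (ψ u) ((σ * ‖a‖⁻¹) • a) := by
    refine ⟨?_, h.mem_tangentConeAt_boundary hu _, ?_⟩
    · rw [norm_smul, norm_mul, norm_inv, norm_norm, Real.norm_eq_abs, hσabs, one_mul,
        inv_mul_cancel₀ ha0.ne']
    · rw [hrot]
      refine h.fderiv_mem_posTangentConeAt hu ?_
      rw [← mul_assoc, hσ1, one_mul]
      have : 0 ≤ ‖a‖⁻¹ * w.im := by positivity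
      simpa using this
  have huniq : ∀ t, IsPositiveUnitTangent M N (ψ u) t → t = (σ * ‖a‖⁻¹) • a := by
    intro t ht
    obtain ⟨r, hr⟩ : ∃ r : ℝ, t = r • a :=
      ⟨_, h.eq_smul_of_mem_tangentConeAt_boundary hu ht.tangent⟩
    have h1 := h.im_fderiv_nonneg hu ht.inward
    rw [hr, hrot, h.fderiv_coord_fderiv_param hu] at h1
    have h2 : 0 ≤ σ * r := by
      have : 0 ≤ (σ * r) * w.im := by simpa using h1
      exact nonneg_of_mul_nonneg_left this hw
    have h3 := ht.norm_eq_one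
    rw [hr, norm_smul, Real.norm_eq_abs] at h3
    have h4 : σ * r = |r| := by rw [← abs_of_nonneg h2, abs_mul, hσabs, one_mul]
    have h5 : r = σ * ‖a‖⁻¹ := by
      rw [← eq_inv_of_mul_eq_one_left h3, ← h4, ← mul_assoc, hσ1, one_mul]
    rw [hr, h5]
  exact huniq _ (Classical.epsilon_spec ⟨_, hex⟩)

/-- The derivative of the normal along the boundary in a patch. -/
theorem boundaryNormalDeriv_eq (h : IsPatch M W Ω ψ π) (hσ1 : σ * σ = 1)
    (hσ : ∀ z ∈ Ω ∩ upperHalf, N (ψ z) = σ • paramNormal ψ z) {u : ℝ} (hu : (u : ℂ) ∈ Ω) :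
    boundaryNormalDeriv M N (ψ u) = ‖fderiv ℝ ψ u 1‖⁻¹ • fderiv ℝ (paramNormal ψ) u 1 := by
  rw [boundaryNormalDeriv, h.boundaryTangent_eq hσ1 hσ hu, ← map_smul,
    h.tangentialDeriv_normal hσ hu (ofReal_im u).ge, map_smul, smul_smul, ← mul_assoc, hσ1, one_mul]

end IsPatch

end ParamNormal

/-! ### The integral identities for fields supported in a patch -/

section LocalIdentity

open Filter Topology Complex Module

/-- The alternating form whose value on the standard basis of the plane is `curlForm`. -/
noncomputable def curlPair (A B C : ℂ →L[ℝ] E3) (t n : E3) (p q : ℂ) : ℝ :=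
  ⟪A p ×ᵥ n + t ×ᵥ B p, C q⟫ - ⟪A q ×ᵥ n + t ×ᵥ B q, C p⟫

theorem curlForm_eq_curlPair (T n Y : ℂ → E3) (z : ℂ) :
    curlForm T n Y z =
      curlPair (fderiv ℝ T z) (fderiv ℝ n z) (fderiv ℝ Y z) (T z) (n z) 1 I := rfl

/-- An alternating form on the plane is a multiple of the determinant. -/
theorem curlPair_eq_det_mul (A B C : ℂ →L[ℝ] E3) (t n : E3) (p q : ℂ) :
    curlPair A B C t n p q = (p.re * q.im - p.im * q.re) * curlPair A B C t n 1 I := by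
  simp only [curlPair]
  rw [map_eq_re_smul_add_im_smul A p, map_eq_re_smul_add_im_smul A q,
    map_eq_re_smul_add_im_smul B p, map_eq_re_smul_add_im_smul B q,
    map_eq_re_smul_add_im_smul C p, map_eq_re_smul_add_im_smul C q]
  simp only [add_cross, cross_add, smul_cross, cross_smul, inner_add_left, inner_add_right,
    real_inner_smul_left, real_inner_smul_right]
  ring

section Frame

variable {A B L : ℂ →L[ℝ] E3} {t n N P Q : E3} {p q : ℂ} {σ k₁ k₂ : ℝ}

theorem cross_of_orthonormal (hP : ‖P‖ = 1) (hQ : ‖Q‖ = 1) (hPQ : ⟪P, Q⟫ = 0)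
    (hN : P ×ᵥ Q = N) : N ×ᵥ Q = -P ∧ N ×ᵥ P = Q ∧ Q ×ᵥ P = -N := by
  have hQP : ⟪Q, P⟫ = 0 := by rw [real_inner_comm, hPQ]
  refine ⟨?_, ?_, ?_⟩
  · rw [← hN, cross_cross_left, hPQ, real_inner_self_eq_norm_sq, hQ]; simp
  · rw [← hN, cross_cross_left, hQP, real_inner_self_eq_norm_sq, hP]; simp
  · rw [← hN]; ext i; fin_cases i <;> simp [cross_eq_coord] <;> ring

/-- The density of `d⟪V × N, dX⟫` in the principal frame. -/
theorem curlPair_param (hσ : σ * σ = 1) (hn : N = σ • n) (hP : ‖P‖ = 1) (hQ : ‖Q‖ = 1)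
    (hPQ : ⟪P, Q⟫ = 0) (hN : P ×ᵥ Q = N) (hp : L p = P) (hq : L q = Q)
    (hBp : σ • B p = -(k₁ • P)) (hBq : σ • B q = -(k₂ • Q)) :
    curlPair A B L t n p q = -(σ * (⟪A p, P⟫ + ⟪A q, Q⟫ + (k₁ + k₂) * ⟪t, N⟫)) := by
  have hn' : n = σ • N := by rw [hn, smul_smul, hσ, one_smul]
  have hBp' : B p = -((σ * k₁) • P) := by
    rw [mul_smul, ← smul_neg, ← hBp, smul_smul, hσ, one_smul]
  have hBq' : B q = -((σ * k₂) • Q) := by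
    rw [mul_smul, ← smul_neg, ← hBq, smul_smul, hσ, one_smul]
  obtain ⟨hNQ, hNP, hQP⟩ := cross_of_orthonormal hP hQ hPQ hN
  rw [curlPair, hp, hq, hBp', hBq', hn']
  simp only [inner_add_left, cross_neg_right, cross_smul, inner_neg_left, real_inner_smul_left]
  simp only [inner_cross_rotate, inner_neg_right, hNQ, hNP, hN, hQP]
  ring

/-- The density of `d⟪V × N, dN⟫` in the principal frame. -/
theorem curlPair_normal (hσ : σ * σ = 1) (hn : N = σ • n) (hP : ‖P‖ = 1) (hQ : ‖Q‖ = 1)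
    (hPQ : ⟪P, Q⟫ = 0) (hN : P ×ᵥ Q = N)
    (hBp : σ • B p = -(k₁ • P)) (hBq : σ • B q = -(k₂ • Q)) :
    curlPair A B B t n p q = k₂ * ⟪A p, P⟫ + k₁ * ⟪A q, Q⟫ + 2 * (k₁ * k₂) * ⟪t, N⟫ := by
  have hn' : n = σ • N := by rw [hn, smul_smul, hσ, one_smul]
  have hBp' : B p = -((σ * k₁) • P) := by
    rw [mul_smul, ← smul_neg, ← hBp, smul_smul, hσ, one_smul]
  have hBq' : B q = -((σ * k₂) • Q) := by
    rw [mul_smul, ← smul_neg, ← hBq, smul_smul, hσ, one_smul]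
  obtain ⟨hNQ, hNP, hQP⟩ := cross_of_orthonormal hP hQ hPQ hN
  rw [curlPair, hBp', hBq', hn']
  simp only [inner_add_left, cross_neg_right, cross_smul, inner_neg_left,
    inner_neg_right, real_inner_smul_left, real_inner_smul_right]
  simp only [inner_cross_rotate, inner_neg_right, hNQ, hNP, hN, hQP]
  linear_combination (k₂ * ⟪A p, P⟫ + k₁ * ⟪A q, Q⟫ + 2 * (k₁ * k₂) * ⟪t, N⟫) * hσ

end Frame

/-- The surface integrand `V_p · P + V_q · Q + 2 H V · N`. -/
noncomputable def meanIntegrand (N P Q : E3 → E3) (κ₁ κ₂ : E3 → ℝ) (V : E3 → E3) (x : E3) : ℝ :=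
  ⟪fderiv ℝ V x (P x), P x⟫ + ⟪fderiv ℝ V x (Q x), Q x⟫
    + 2 * meanCurvature κ₁ κ₂ x * ⟪V x, N x⟫

/-- The surface integrand `κ₂ V_p · P + κ₁ V_q · Q + 2 K V · N`. -/
noncomputable def gaussIntegrand (N P Q : E3 → E3) (κ₁ κ₂ : E3 → ℝ) (V : E3 → E3) (x : E3) : ℝ :=
  κ₂ x * ⟪fderiv ℝ V x (P x), P x⟫ + κ₁ x * ⟪fderiv ℝ V x (Q x), Q x⟫
    + 2 * gaussCurvature κ₁ κ₂ x * ⟪V x, N x⟫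

/-- Both integral identities hold for the field `V`, with absolutely convergent integrals. -/
structure FieldIdentities (M : Set E3) (N P Q : E3 → E3) (κ₁ κ₂ : E3 → ℝ) (V : E3 → E3) :
    Prop where
  boundaryIntegrable_mean : BoundaryIntegrable M fun x => ⟪V x ×ᵥ N x, boundaryTangent M N x⟫
  surfaceIntegrable_mean : SurfaceIntegrable M (meanIntegrand N P Q κ₁ κ₂ V)
  mean : boundaryIntegral M (fun x => ⟪V x ×ᵥ N x, boundaryTangent M N x⟫) =
    -surfaceIntegral M (meanIntegrand N P Q κ₁ κ₂ V)
  boundaryIntegrable_gauss :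
    BoundaryIntegrable M fun x => ⟪V x ×ᵥ N x, boundaryNormalDeriv M N x⟫
  surfaceIntegrable_gauss : SurfaceIntegrable M (gaussIntegrand N P Q κ₁ κ₂ V)
  gauss : boundaryIntegral M (fun x => ⟪V x ×ᵥ N x, boundaryNormalDeriv M N x⟫) =
    surfaceIntegral M (gaussIntegrand N P Q κ₁ κ₂ V)

section Support

variable {α F : Type*} [MeasurableSpace α] [NormedAddCommGroup F]
  {μ : Measure α} {s W : Set α} {f : α → F}

theorem integrableOn_inter_iff_of_forall_notMem (hW : MeasurableSet W) (hf : ∀ x ∉ W, f x = 0) :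
    IntegrableOn f (s ∩ W) μ ↔ IntegrableOn f s μ := by
  have h : W.indicator f = f := indicator_eq_self.2 fun x hx => by_contra fun h => hx (hf x h)
  conv_rhs => rw [IntegrableOn, ← h, integrable_indicator_iff hW, IntegrableOn,
    Measure.restrict_restrict hW, inter_comm]
  rfl

theorem setIntegral_inter_of_forall_notMem [NormedSpace ℝ F] (hW : MeasurableSet W)
    (hf : ∀ x ∉ W, f x = 0) :
    ∫ x in s ∩ W, f x ∂μ = ∫ x in s, f x ∂μ := by
  have h : W.indicator f = f := indicator_eq_self.2 fun x hx => by_contra fun h => hx (hf x h)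
  rw [← setIntegral_indicator hW, h]

end Support

namespace IsPatch

variable {M W : Set E3} {Ω : Set ℂ} {ψ : ℂ → E3} {π : E3 → ℂ} {N P Q : E3 → E3}
  {κ₁ κ₂ : E3 → ℝ} {σ : ℝ}

theorem continuousOn_fderiv (h : IsPatch M W Ω ψ π) : ContinuousOn (fderiv ℝ ψ) Ω :=
  h.contDiffOn_param.continuousOn_fderiv_of_isOpen h.isOpen_domain (by simp)

/-- Surface integrals in a patch. -/
theorem surfaceIntegral_param (h : IsPatch M W Ω ψ π) {g : E3 → ℝ} (hg : ∀ x ∉ W, g x = 0)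
    {k : ℂ → ℝ} (hk : ∀ z ∈ Ω ∩ upperHalf, ‖areaVector ψ z‖ * g (ψ z) = k z)
    (hint : IntegrableOn k (Ω ∩ upperHalf)) :
    SurfaceIntegrable M g ∧ surfaceIntegral M g = ∫ z in Ω ∩ upperHalf, k z := by
  have hW := h.isOpen_target.measurableSet
  have hm : MeasurableSet (Ω ∩ upperHalf) :=
    h.isOpen_domain.measurableSet.inter measurableSet_upperHalf
  have hd : ∀ z ∈ Ω, HasStrictFDerivAt ψ (fderiv ℝ ψ z) z := fun z hz =>
    (h.contDiffAt_param hz).hasStrictFDerivAt (by simp)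
  have h1 := integrableOn_image_iff_normDet_smul h.isOpen_domain hd h.continuousOn_fderiv
    (fun z hz => h.injective_fderiv hz) h.injOn_param inter_subset_left hm g
  have h2 := integral_image_eq_integral_normDet_smul h.isOpen_domain hd h.continuousOn_fderiv
    (fun z hz => h.injective_fderiv hz) h.injOn_param inter_subset_left hm g
  rw [h.image_upperHalf, Complex.finrank_real_complex] at h1 h2
  have hk' : ∀ z ∈ Ω ∩ upperHalf,
      (fderiv ℝ ψ z : ℂ →ₗ[ℝ] E3).normDet • g (ψ z) = k z := fun z hz => by
    rw [normDet_eq_norm_cross, smul_eq_mul]; exact hk z hz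
  constructor
  · rw [SurfaceIntegrable, ← integrableOn_inter_iff_of_forall_notMem hW hg, h1]
    exact hint.congr_fun (fun z hz => (hk' z hz).symm) hm
  · rw [surfaceIntegral, ← setIntegral_inter_of_forall_notMem hW hg, h2]
    exact setIntegral_congr_fun hm hk'

/-- Boundary integrals in a patch. -/
theorem boundaryIntegral_param (h : IsPatch M W Ω ψ π) {g : E3 → ℝ} (hg : ∀ x ∉ W, g x = 0)
    {k : ℝ → ℝ} (hk : ∀ u : ℝ, (u : ℂ) ∈ Ω → ‖fderiv ℝ ψ u 1‖ * g (ψ u) = k u)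
    (hint : IntegrableOn k {u : ℝ | (u : ℂ) ∈ Ω}) :
    BoundaryIntegrable M g ∧ boundaryIntegral M g = ∫ u in {u : ℝ | (u : ℂ) ∈ Ω}, k u := by
  have hW := h.isOpen_target.measurableSet
  have hO : IsOpen {u : ℝ | (u : ℂ) ∈ Ω} := h.isOpen_domain.preimage continuous_ofReal
  have hd : ∀ u ∈ {u : ℝ | (u : ℂ) ∈ Ω}, HasStrictFDerivAt (fun u : ℝ => ψ u)
      ((fderiv ℝ ψ u).comp ofRealCLM) u := fun u hu =>
    ((h.contDiffAt_param hu).hasStrictFDerivAt (by simp)).comp u ofRealCLM.hasStrictFDerivAt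
  have hc : ContinuousOn (fun u : ℝ => (fderiv ℝ ψ u).comp ofRealCLM) {u : ℝ | (u : ℂ) ∈ Ω} :=
    (h.continuousOn_fderiv.comp continuous_ofReal.continuousOn fun u hu => hu).clm_comp
      continuousOn_const
  have hi : ∀ u ∈ {u : ℝ | (u : ℂ) ∈ Ω},
      Function.Injective ((fderiv ℝ ψ u).comp ofRealCLM) := fun u hu =>
    (h.injective_fderiv hu).comp ofReal_injective
  have hinj : InjOn (fun u : ℝ => ψ u) {u : ℝ | (u : ℂ) ∈ Ω} :=
    h.injOn_param.comp ofReal_injective.injOn fun u hu => hu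
  have h1 := integrableOn_image_iff_normDet_smul hO hd hc hi hinj subset_rfl hO.measurableSet g
  have h2 := integral_image_eq_integral_normDet_smul hO hd hc hi hinj subset_rfl hO.measurableSet g
  rw [h.image_real, finrank_self] at h1 h2
  have hk' : ∀ u ∈ {u : ℝ | (u : ℂ) ∈ Ω},
      (((fderiv ℝ ψ u).comp ofRealCLM : ℝ →L[ℝ] E3) : ℝ →ₗ[ℝ] E3).normDet • g (ψ u) = k u := by
    intro u hu
    rw [normDet_eq_norm_map_one, smul_eq_mul, ← hk u hu]
    simp
  constructor
  · rw [BoundaryIntegrable, ← integrableOn_inter_iff_of_forall_notMem hW hg, h1]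
    exact hint.congr_fun (fun z hz => (hk' z hz).symm) hO.measurableSet
  · rw [boundaryIntegral, ← setIntegral_inter_of_forall_notMem hW hg, h2]
    exact setIntegral_congr_fun hO.measurableSet hk'

/-- The tangent space is the image of the derivative of the parametrization, since the double
rotation `n × (n × v)` about the normal maps to it. -/
theorem exists_fderiv_eq (h : IsPatch M W Ω ψ π) {z : ℂ} (hz : z ∈ Ω) {v : E3}
    (hv : ⟪paramNormal ψ z, v⟫ = 0) : ∃ p, fderiv ℝ ψ z p = v := by
  have hrot : ∀ v, ∃ p, fderiv ℝ ψ z p = paramNormal ψ z ×ᵥ v := fun v =>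
    ⟨‖areaVector ψ z‖⁻¹ • (⟪fderiv ℝ ψ z 1, v⟫ • I - ⟪fderiv ℝ ψ z I, v⟫ • (1 : ℂ)), by
      rw [map_smul, map_sub, map_smul, map_smul, ← cross_cross_left, paramNormal,
        smul_cross, areaVector]⟩
  obtain ⟨p, hp⟩ := hrot (paramNormal ψ z ×ᵥ v)
  refine ⟨-p, ?_⟩
  rw [map_neg, hp, cross_cross_right, hv, real_inner_self_eq_norm_sq, h.norm_paramNormal hz]
  simp

/-- In a patch both surface integrands are, up to sign, the coefficients of exact two-forms. -/
theorem norm_areaVector_mul_integrand (h : IsPatch M W Ω ψ π)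
    (hPQ : IsPrincipalFrame M N P Q κ₁ κ₂) (hσ1 : σ * σ = 1)
    (hσ : ∀ z ∈ Ω ∩ upperHalf, N (ψ z) = σ • paramNormal ψ z) {V : E3 → E3} {z : ℂ}
    (hz : z ∈ Ω ∩ upperHalf) (hV : DifferentiableAt ℝ V (ψ z)) :
    ‖areaVector ψ z‖ * meanIntegrand N P Q κ₁ κ₂ V (ψ z) =
        -curlForm (fun z => V (ψ z)) (paramNormal ψ) ψ z ∧
      ‖areaVector ψ z‖ * gaussIntegrand N P Q κ₁ κ₂ V (ψ z) =
        σ * curlForm (fun z => V (ψ z)) (paramNormal ψ) (paramNormal ψ) z := by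
  have hzM : ψ z ∈ M := (h.mem_iff z hz.1).2 hz.2
  have hN := hPQ.oriented _ hzM
  have hnN : paramNormal ψ z = σ • N (ψ z) := by rw [hσ z hz, smul_smul, hσ1, one_smul]
  obtain ⟨p, hp⟩ := h.exists_fderiv_eq hz.1 (v := P (ψ z)) (by
    rw [hnN, ← hN, inner_smul_left, inner_cross_left, mul_zero])
  obtain ⟨q, hq⟩ := h.exists_fderiv_eq hz.1 (v := Q (ψ z)) (by
    rw [hnN, ← hN, inner_smul_left, inner_cross_right, mul_zero])
  have hBp : σ • fderiv ℝ (paramNormal ψ) z p = -(κ₁ (ψ z) • P (ψ z)) := by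
    rw [← h.tangentialDeriv_normal hσ hz.1 hz.2, hp]
    exact hPQ.deriv_P _ hzM
  have hBq : σ • fderiv ℝ (paramNormal ψ) z q = -(κ₂ (ψ z) • Q (ψ z)) := by
    rw [← h.tangentialDeriv_normal hσ hz.1 hz.2, hq]
    exact hPQ.deriv_Q _ hzM
  have hT : ∀ w, fderiv ℝ (fun z => V (ψ z)) z w = fderiv ℝ V (ψ z) (fderiv ℝ ψ z w) := fun w =>
    congrArg (fun A : ℂ →L[ℝ] E3 => A w)
      (hV.hasFDerivAt.comp z (h.hasFDerivAt_param hz.1)).fderiv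
  -- comparing `P × Q = N` with `ψ_u × ψ_v` gives the determinant of `(p, q)`
  have hdet : ‖areaVector ψ z‖ * (p.re * q.im - p.im * q.re) = σ := by
    have h1 := cross_map_map (fderiv ℝ ψ z) p q
    rw [hp, hq, hN, hσ z hz] at h1
    change _ = _ • areaVector ψ z at h1
    rw [h.areaVector_eq_smul_paramNormal hz.1, smul_smul] at h1
    have h2 : paramNormal ψ z ≠ 0 := norm_ne_zero_iff.1 (by rw [h.norm_paramNormal hz.1]; simp)
    rw [smul_left_injective ℝ h2 h1, mul_comm]
  have hP := hPQ.norm_P _ hzM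
  have hQ := hPQ.norm_Q _ hzM
  have hort := hPQ.orthogonal _ hzM
  constructor
  · have h1 := curlPair_param (A := fderiv ℝ (fun z => V (ψ z)) z) (t := V (ψ z)) hσ1 (hσ z hz)
      hP hQ hort hN hp hq hBp hBq
    rw [curlPair_eq_det_mul, ← curlForm_eq_curlPair (fun z => V (ψ z)), hT, hT, hp, hq] at h1
    simp only [meanIntegrand, meanCurvature]
    linear_combination (σ * ‖areaVector ψ z‖) * h1 -
      (σ * curlForm (fun z => V (ψ z)) (paramNormal ψ) ψ z) * hdet -
      (curlForm (fun z => V (ψ z)) (paramNormal ψ) ψ z + ‖areaVector ψ z‖ *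
        (⟪fderiv ℝ V (ψ z) (P (ψ z)), P (ψ z)⟫ + ⟪fderiv ℝ V (ψ z) (Q (ψ z)), Q (ψ z)⟫ +
          (κ₁ (ψ z) + κ₂ (ψ z)) * ⟪V (ψ z), N (ψ z)⟫)) * hσ1
  · have h1 := curlPair_normal (A := fderiv ℝ (fun z => V (ψ z)) z) (t := V (ψ z)) hσ1 (hσ z hz)
      hP hQ hort hN hBp hBq
    rw [curlPair_eq_det_mul, ← curlForm_eq_curlPair (fun z => V (ψ z)), hT, hT, hp, hq] at h1
    simp only [gaussIntegrand, gaussCurvature]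
    rw [← h1, ← mul_assoc, hdet]

/-- The integral identities for a field supported in a patch, from Green's theorem in the plane. -/
theorem fieldIdentities (h : IsPatch M W Ω ψ π) (hN : IsUnitNormalField M N)
    (hPQ : IsPrincipalFrame M N P Q κ₁ κ₂) {V : E3 → E3} (hV : ContDiff ℝ 1 V)
    (hVc : HasCompactSupport V) (hVW : tsupport V ⊆ W) : FieldIdentities M N P Q κ₁ κ₂ V := by
  obtain ⟨σ, hσ1, hσ⟩ := h.exists_sign hN
  have hV0 : ∀ x ∉ W, V x = 0 := fun x hx =>
    image_eq_zero_of_notMem_tsupport fun hx' => hx (hVW hx')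
  have hV0' : ∀ x ∉ W, fderiv ℝ V x = 0 := fun x hx =>
    image_eq_zero_of_notMem_tsupport fun hx' => hx (hVW (tsupport_fderiv_subset ℝ hx'))
  have hT : ContDiffOn ℝ 1 (fun z => V (ψ z)) Ω :=
    hV.comp_contDiffOn (h.contDiffOn_param.of_le (by simp))
  have hT0 : ∀ z ∈ Ω, z ∉ Ω ∩ ψ ⁻¹' tsupport V → V (ψ z) = 0 := fun z hz hz' =>
    image_eq_zero_of_notMem_tsupport fun hx => hz' ⟨hz, hx⟩
  have hn : ContDiffOn ℝ ∞ (paramNormal ψ) Ω := h.contDiffOn_paramNormal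
  have hle : (2 : WithTop ℕ∞) ≤ ∞ := WithTop.coe_le_coe.2 (le_top : (2 : ℕ∞) ≤ ⊤)
  have key := fun (Y : ℂ → E3) (hY : ContDiffOn ℝ ∞ Y Ω) =>
    setIntegral_curlForm h.isOpen_domain (h.isCompact_preimage _ hVW hVc) inter_subset_left hT hT0
      (hn.of_le (by simp)) (hY.of_le hle)
  obtain ⟨i1, j1, e1⟩ := key ψ h.contDiffOn_param
  obtain ⟨i2, j2, e2⟩ := key (paramNormal ψ) hn
  have hd : ∀ z, DifferentiableAt ℝ V (ψ z) := fun z => hV.differentiable one_ne_zero _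
  obtain ⟨s1, s1'⟩ := h.surfaceIntegral_param (g := meanIntegrand N P Q κ₁ κ₂ V)
    (fun x hx => by simp [meanIntegrand, hV0 x hx, hV0' x hx])
    (fun z hz => (h.norm_areaVector_mul_integrand hPQ hσ1 hσ hz (hd z)).1) i1.neg
  obtain ⟨s2, s2'⟩ := h.surfaceIntegral_param (g := gaussIntegrand N P Q κ₁ κ₂ V)
    (fun x hx => by simp [gaussIntegrand, hV0 x hx, hV0' x hx])
    (fun z hz => (h.norm_areaVector_mul_integrand hPQ hσ1 hσ hz (hd z)).2) (i2.const_mul σ)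
  have hcr : ∀ x ∉ W, V x ×ᵥ N x = 0 := fun x hx => by rw [hV0 x hx, ← crossCLM_apply]; simp
  have hreal : ∀ u : ℝ, (u : ℂ) ∈ Ω → N (ψ u) = σ • paramNormal ψ u := fun u hu =>
    hσ u ⟨hu, (ofReal_im u).ge⟩
  obtain ⟨b1, b1'⟩ := h.boundaryIntegral_param
    (g := fun x => ⟪V x ×ᵥ N x, boundaryTangent M N x⟫)
    (fun x hx => by rw [hcr x hx, inner_zero_left])
    (fun u hu => by
      have ha := (h.norm_fderiv_one_pos hu).ne'
      change _ = ⟪V (ψ u) ×ᵥ paramNormal ψ u, fderiv ℝ ψ u 1⟫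
      rw [h.boundaryTangent_eq hσ1 hσ hu, hreal u hu, cross_smul, real_inner_smul_left,
        real_inner_smul_right]
      field_simp
      rw [pow_two, hσ1, one_mul]) j1
  obtain ⟨b2, b2'⟩ := h.boundaryIntegral_param
    (g := fun x => ⟪V x ×ᵥ N x, boundaryNormalDeriv M N x⟫)
    (k := fun u : ℝ => σ * ⟪V (ψ u) ×ᵥ paramNormal ψ u, fderiv ℝ (paramNormal ψ) u 1⟫)
    (fun x hx => by rw [hcr x hx, inner_zero_left])
    (fun u hu => by
      have ha := (h.norm_fderiv_one_pos hu).ne'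
      rw [h.boundaryNormalDeriv_eq hσ1 hσ hu, hreal u hu, cross_smul, real_inner_smul_left,
        real_inner_smul_right]
      field_simp) (j2.const_mul σ)
  refine ⟨b1, s1, ?_, b2, s2, ?_⟩
  · rw [b1', s1', integral_neg, neg_neg]
    exact e1.symm
  · rw [b2', s2', integral_const_mul, integral_const_mul]
    exact congrArg (σ * ·) e2.symm

end IsPatch

end LocalIdentity

/-! ### From fields supported in patches to arbitrary fields -/

section Globalization

open Filter Topology

/-- The boundary is closed: in a patch it is cut out of `M` by the equation `v = 0`. -/
theorem isClosed_surfaceBoundary {M : Set E3} (hM : IsCompact M) (hS : IsSmoothSurface M) :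
    IsClosed (surfaceBoundary M) := by
  refine isClosed_of_closure_subset fun x hx => ?_
  have hxM : x ∈ M := closure_minimal (fun y hy => hy.1) hM.isClosed hx
  obtain ⟨W, Ω, ψ, π, h, hxW, -⟩ := hS.exists_isPatch hxM isOpen_univ (mem_univ x)
  have hiff : ∀ y ∈ M ∩ W, (y ∈ surfaceBoundary M ↔ (π y).im = 0) := fun y hy => by
    rw [← h.mem_boundary_iff _ (h.mapsTo_coord y hy), h.rightInv y hy]
  rw [hiff x ⟨hxM, hxW⟩]
  by_contra hne
  have hc : ContinuousAt (fun y => (π y).im) x :=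
    Complex.continuous_im.continuousAt.comp (h.hasFDerivAt_coord hxW).continuousAt
  obtain ⟨y, hy, hy0, hyW⟩ := ((mem_closure_iff_frequently.1 hx).and_eventually
    ((hc.eventually_ne hne).and (h.isOpen_target.mem_nhds hxW))).exists
  exact hy0 ((hiff y ⟨hy.1, hyW⟩).1 hy)

variable {M : Set E3} {N P Q : E3 → E3} {κ₁ κ₂ : E3 → ℝ} {V V' : E3 → E3}

namespace FieldIdentities

theorem zero : FieldIdentities M N P Q κ₁ κ₂ (fun _ => 0) := by
  have h0 : ∀ a : E3, (0 : E3) ×ᵥ a = 0 := fun a => by simp [← crossCLM_apply]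
  have hm : meanIntegrand N P Q κ₁ κ₂ (fun _ => 0) = fun _ => 0 := by
    funext x; simp [meanIntegrand]
  have hg : gaussIntegrand N P Q κ₁ κ₂ (fun _ => 0) = fun _ => 0 := by
    funext x; simp [gaussIntegrand]
  constructor <;>
    simp [hm, hg, BoundaryIntegrable, SurfaceIntegrable, boundaryIntegral, surfaceIntegral, h0]

theorem add (h : FieldIdentities M N P Q κ₁ κ₂ V) (h' : FieldIdentities M N P Q κ₁ κ₂ V')
    (hV : Differentiable ℝ V) (hV' : Differentiable ℝ V') :
    FieldIdentities M N P Q κ₁ κ₂ (V + V') := by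
  have e1 : ∀ d : E3 → E3, (fun x => ⟪(V + V') x ×ᵥ N x, d x⟫) =
      fun x => ⟪V x ×ᵥ N x, d x⟫ + ⟪V' x ×ᵥ N x, d x⟫ := fun d => by
    funext x
    rw [Pi.add_apply, add_cross, inner_add_left]
  have hfd : ∀ x, fderiv ℝ (V + V') x = fderiv ℝ V x + fderiv ℝ V' x := fun x =>
    fderiv_add (hV x) (hV' x)
  have e2 : meanIntegrand N P Q κ₁ κ₂ (V + V') =
      fun x => meanIntegrand N P Q κ₁ κ₂ V x + meanIntegrand N P Q κ₁ κ₂ V' x := by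
    funext x
    simp only [meanIntegrand, hfd, Pi.add_apply, add_apply, inner_add_left]
    ring
  have e3 : gaussIntegrand N P Q κ₁ κ₂ (V + V') =
      fun x => gaussIntegrand N P Q κ₁ κ₂ V x + gaussIntegrand N P Q κ₁ κ₂ V' x := by
    funext x
    simp only [gaussIntegrand, hfd, Pi.add_apply, add_apply, inner_add_left]
    ring
  constructor
  · rw [e1]; exact h.boundaryIntegrable_mean.add h'.boundaryIntegrable_mean
  · rw [e2]; exact h.surfaceIntegrable_mean.add h'.surfaceIntegrable_mean
  · rw [e1, e2, boundaryIntegral, surfaceIntegral,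
      integral_add h.boundaryIntegrable_mean h'.boundaryIntegrable_mean,
      integral_add h.surfaceIntegrable_mean h'.surfaceIntegrable_mean, neg_add]
    exact congrArg₂ (· + ·) h.mean h'.mean
  · rw [e1]; exact h.boundaryIntegrable_gauss.add h'.boundaryIntegrable_gauss
  · rw [e3]; exact h.surfaceIntegrable_gauss.add h'.surfaceIntegrable_gauss
  · rw [e1, e3, boundaryIntegral, surfaceIntegral,
      integral_add h.boundaryIntegrable_gauss h'.boundaryIntegrable_gauss,
      integral_add h.surfaceIntegrable_gauss h'.surfaceIntegrable_gauss]
    exact congrArg₂ (· + ·) h.gauss h'.gauss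

theorem sum {ι : Type*} {F : ι → E3 → E3} (s : Finset ι)
    (h : ∀ i ∈ s, FieldIdentities M N P Q κ₁ κ₂ (F i)) (hF : ∀ i ∈ s, Differentiable ℝ (F i)) :
    FieldIdentities M N P Q κ₁ κ₂ (∑ i ∈ s, F i) := by
  classical
  induction s using Finset.induction_on with
  | empty => simpa using! (zero : FieldIdentities M N P Q κ₁ κ₂ fun _ => 0)
  | insert i s his ih =>
    rw [Finset.sum_insert his]
    exact (h i (Finset.mem_insert_self i s)).add
      (ih (fun j hj => h j (Finset.mem_insert_of_mem hj))
        fun j hj => hF j (Finset.mem_insert_of_mem hj))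
      (hF i (Finset.mem_insert_self i s))
      (Differentiable.sum fun j hj => hF j (Finset.mem_insert_of_mem hj))

/-- The identities depend only on the germ of the field along the surface. -/
theorem congr (hM : IsCompact M) (hS : IsSmoothSurface M)
    (h : FieldIdentities M N P Q κ₁ κ₂ V) (hV : ∀ x ∈ M, V =ᶠ[𝓝 x] V') :
    FieldIdentities M N P Q κ₁ κ₂ V' := by
  have hMm := hM.measurableSet
  have hBm := (isClosed_surfaceBoundary hM hS).measurableSet
  have e1 : ∀ d : E3 → E3, EqOn (fun x => ⟪V x ×ᵥ N x, d x⟫) (fun x => ⟪V' x ×ᵥ N x, d x⟫)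
      (surfaceBoundary M) := fun d x hx => by
    simp only [(hV x hx.1).eq_of_nhds]
  have e2 : EqOn (meanIntegrand N P Q κ₁ κ₂ V) (meanIntegrand N P Q κ₁ κ₂ V') M := fun x hx => by
    simp only [meanIntegrand, (hV x hx).eq_of_nhds, (hV x hx).fderiv_eq]
  have e3 : EqOn (gaussIntegrand N P Q κ₁ κ₂ V) (gaussIntegrand N P Q κ₁ κ₂ V') M :=
    fun x hx => by simp only [gaussIntegrand, (hV x hx).eq_of_nhds, (hV x hx).fderiv_eq]
  constructor
  · exact h.boundaryIntegrable_mean.congr_fun (e1 _) hBm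
  · exact h.surfaceIntegrable_mean.congr_fun e2 hMm
  · rw [boundaryIntegral, surfaceIntegral, ← setIntegral_congr_fun hBm (e1 _),
      ← setIntegral_congr_fun hMm e2]
    exact h.mean
  · exact h.boundaryIntegrable_gauss.congr_fun (e1 _) hBm
  · exact h.surfaceIntegrable_gauss.congr_fun e3 hMm
  · rw [boundaryIntegral, surfaceIntegral, ← setIntegral_congr_fun hBm (e1 _),
      ← setIntegral_congr_fun hMm e3]
    exact h.gauss

end FieldIdentities

/-- The two integral identities, by a partition of unity subordinate to a cover of the surface by
patches. -/
theorem fieldIdentities_of_contDiffOn (hM : IsCompact M) (hS : IsSmoothSurface M)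
    (hN : IsUnitNormalField M N) (hPQ : IsPrincipalFrame M N P Q κ₁ κ₂) {U : Set E3}
    (hU : IsOpen U) (hMU : M ⊆ U) (hV : ContDiffOn ℝ 1 V U) :
    FieldIdentities M N P Q κ₁ κ₂ V := by
  classical
  choose! W Ω ψ π hpatch hxW hWU using fun x (hx : x ∈ M) =>
    hS.exists_isPatch hx (hU.inter (Metric.isOpen_ball (x := x) (ε := 1)))
      ⟨hMU hx, Metric.mem_ball_self one_pos⟩
  obtain ⟨t, htM, htc⟩ := hM.elim_nhds_subcover W fun x hx =>
    (hpatch x hx).isOpen_target.mem_nhds (hxW x hx)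
  set O : Option t → Set E3 := fun i => i.elim Mᶜ fun x => W x with hO
  obtain ⟨ρ, hρ⟩ := SmoothPartitionOfUnity.exists_isSubordinate
    (modelWithCornersSelf ℝ E3) (isClosed_univ (X := E3)) O
    (fun i => by
      cases i with
      | none => exact hM.isClosed.isOpen_compl
      | some x => exact (hpatch x (htM x x.2)).isOpen_target)
    (fun y _ => by
      by_cases hy : y ∈ M
      · obtain ⟨x, hx, hyx⟩ := mem_iUnion₂.1 (htc hy)
        exact mem_iUnion.2 ⟨some ⟨x, hx⟩, hyx⟩
      · exact mem_iUnion.2 ⟨none, hy⟩)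
  have hρc : ∀ i, ContDiff ℝ ∞ (ρ i) := fun i => (ρ i).contMDiff.contDiff
  set F : t → E3 → E3 := fun x y => ρ (some x) y • V y with hF
  have hts : ∀ x : t, tsupport (F x) ⊆ tsupport (ρ (some x)) := fun x =>
    tsupport_smul_subset_left (ρ (some x)) V
  have hW : ∀ x : t, tsupport (ρ (some x)) ⊆ W x := fun x => hρ (some x)
  have hFc : ∀ x : t, ContDiff ℝ 1 (F x) := by
    intro x
    refine contDiff_iff_contDiffAt.2 fun y => ?_
    by_cases hy : y ∈ tsupport (F x)
    swap
    · exact contDiffAt_const.congr_of_eventuallyEq (notMem_tsupport_iff_eventuallyEq.1 hy)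
    have hyU : y ∈ U := (hWU x (htM x x.2) (hW x (hts x hy))).1
    exact ((hρc (some x)).of_le (by simp)).contDiffAt.smul (hV.contDiffAt (hU.mem_nhds hyU))
  have hFs : ∀ x : t, HasCompactSupport (F x) := fun x =>
    Metric.isCompact_of_isClosed_isBounded (isClosed_tsupport _)
      (Metric.isBounded_ball.subset fun y hy => (hWU x (htM x x.2) (hW x (hts x hy))).2)
  have hsum := FieldIdentities.sum (F := F) Finset.univ
    (fun x _ => (hpatch x (htM x x.2)).fieldIdentities hN hPQ (hFc x) (hFs x)
      ((hts x).trans (hW x)))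
    fun x _ => (hFc x).differentiable one_ne_zero
  refine hsum.congr hM hS fun x hx => ?_
  -- near `M` the function supported away from `M` vanishes, and the others add up to one
  have hx0 : x ∉ tsupport (ρ none) := fun h => hρ none h hx
  filter_upwards [(isClosed_tsupport (ρ none)).isOpen_compl.mem_nhds hx0] with y hy
  have h1 := ρ.sum_eq_one (mem_univ y)
  rw [finsum_eq_sum_of_fintype, Fintype.sum_option, image_eq_zero_of_notMem_tsupport hy,
    zero_add] at h1
  rw [Finset.sum_apply, ← Finset.sum_smul, h1, one_smul]

end Globalization

/-! ### Vector identities from scalar ones -/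

section VectorIdentities

variable {α β : Type*} [MeasurableSpace α] [MeasurableSpace β] {μ : Measure α} {ν : Measure β}

theorem integrable_of_forall_inner {f : α → E3} (hf : ∀ e : E3, Integrable (fun x => ⟪e, f x⟫) μ) :
    Integrable f μ := by
  have h : f = fun x => ∑ i, ⟪EuclideanSpace.basisFun (Fin 3) ℝ i, f x⟫ •
      EuclideanSpace.basisFun (Fin 3) ℝ i := by
    funext x
    exact ((EuclideanSpace.basisFun (Fin 3) ℝ).sum_repr' (f x)).symm
  rw [h]
  exact integrable_finsetSum _ fun i _ => (hf _).smul_const _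

/-- An identity of vector integrals follows from the scalar identities for all inner products. -/
theorem vector_integral_eq_of_forall_inner {f : α → E3} {g : β → E3} {c : ℝ} (hc : c ≠ 0)
    (hf : ∀ e : E3, Integrable (fun x => ⟪e, f x⟫) μ)
    (hg : ∀ e : E3, Integrable (fun x => c * ⟪e, g x⟫) ν)
    (h : ∀ e : E3, ∫ x, ⟪e, f x⟫ ∂μ = ∫ x, c * ⟪e, g x⟫ ∂ν) :
    Integrable f μ ∧ Integrable g ν ∧ ∫ x, f x ∂μ = c • ∫ x, g x ∂ν := by
  have hf' := integrable_of_forall_inner hf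
  have hg' := integrable_of_forall_inner fun e =>
    (integrable_const_mul_iff (isUnit_iff_ne_zero.2 hc) _).1 (hg e)
  refine ⟨hf', hg', ext_inner_left ℝ fun e => ?_⟩
  rw [← integral_inner hf', h, inner_smul_right, integral_const_mul, integral_inner hg']

variable {M : Set E3} {N P Q : E3 → E3} {κ₁ κ₂ : E3 → ℝ}

/-- The vector form of the identities for a family of fields `Z e` that is adjoint, at each point
`x`, to a linear map `T x`, and whose derivatives are skew-symmetric, so that only the curvature
terms remain. -/
theorem FieldIdentities.vector {Z : E3 → E3 → E3} {T : E3 → E3 →ₗ[ℝ] E3}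
    (h : ∀ e, FieldIdentities M N P Q κ₁ κ₂ (Z e))
    (hZ : ∀ e x y, ⟪Z e x, y⟫ = ⟪e, T x y⟫)
    (hd : ∀ e x y, ⟪fderiv ℝ (Z e) x y, y⟫ = 0) :
    (BoundaryIntegrable M (fun x => T x (N x ×ᵥ boundaryTangent M N x)) ∧
      SurfaceIntegrable M (fun x => meanCurvature κ₁ κ₂ x • T x (N x)) ∧
      boundaryIntegral M (fun x => T x (N x ×ᵥ boundaryTangent M N x)) =
        -((2 : ℝ) • surfaceIntegral M (fun x => meanCurvature κ₁ κ₂ x • T x (N x)))) ∧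
    (BoundaryIntegrable M (fun x => T x (N x ×ᵥ boundaryNormalDeriv M N x)) ∧
      SurfaceIntegrable M (fun x => gaussCurvature κ₁ κ₂ x • T x (N x)) ∧
      boundaryIntegral M (fun x => T x (N x ×ᵥ boundaryNormalDeriv M N x)) =
        (2 : ℝ) • surfaceIntegral M (fun x => gaussCurvature κ₁ κ₂ x • T x (N x))) := by
  have hb : ∀ (d : E3 → E3) e, (fun x => ⟪Z e x ×ᵥ N x, d x⟫) =
      fun x => ⟪e, T x (N x ×ᵥ d x)⟫ := fun d e => by
    funext x
    rw [inner_cross_rotate, hZ]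
  have hm : ∀ e, meanIntegrand N P Q κ₁ κ₂ (Z e) =
      fun x => 2 * ⟪e, meanCurvature κ₁ κ₂ x • T x (N x)⟫ := fun e => by
    funext x
    rw [meanIntegrand, hd, hd, hZ, inner_smul_right]
    ring
  have hg : ∀ e, gaussIntegrand N P Q κ₁ κ₂ (Z e) =
      fun x => 2 * ⟪e, gaussCurvature κ₁ κ₂ x • T x (N x)⟫ := fun e => by
    funext x
    rw [gaussIntegrand, hd, hd, hZ, inner_smul_right]
    ring
  have hneg : ∀ e, (fun x => -2 * ⟪e, meanCurvature κ₁ κ₂ x • T x (N x)⟫) =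
      fun x => -meanIntegrand N P Q κ₁ κ₂ (Z e) x := fun e => by
    rw [hm]; funext x; ring
  constructor
  · rw [← neg_smul]
    refine vector_integral_eq_of_forall_inner (by norm_num) (fun e => ?_) (fun e => ?_) fun e => ?_
    · rw [← hb]; exact (h e).boundaryIntegrable_mean
    · rw [hneg]; exact (h e).surfaceIntegrable_mean.neg
    · rw [← hb, hneg, integral_neg]; exact (h e).mean
  · refine vector_integral_eq_of_forall_inner (by norm_num) (fun e => ?_) (fun e => ?_) fun e => ?_
    · rw [← hb]; exact (h e).boundaryIntegrable_gauss
    · rw [← hg]; exact (h e).surfaceIntegrable_gauss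
    · rw [← hb, ← hg]; exact (h e).gauss

/-- Minkowski's formulas are the identities for the position field. -/
theorem FieldIdentities.position (hM : IsCompact M) (hPQ : IsPrincipalFrame M N P Q κ₁ κ₂)
    (h : FieldIdentities M N P Q κ₁ κ₂ fun x => x) :
    (SurfaceIntegrable M (fun x => 1 + meanCurvature κ₁ κ₂ x * ⟪x, N x⟫) ∧
      boundaryIntegral M (fun x => ⟪x ×ᵥ N x, boundaryTangent M N x⟫) =
        -(2 * surfaceIntegral M (fun x => 1 + meanCurvature κ₁ κ₂ x * ⟪x, N x⟫))) ∧
    (SurfaceIntegrable M (fun x => meanCurvature κ₁ κ₂ x + gaussCurvature κ₁ κ₂ x * ⟪x, N x⟫) ∧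
      boundaryIntegral M (fun x => ⟪x ×ᵥ N x, boundaryNormalDeriv M N x⟫) =
        2 * surfaceIntegral M
          (fun x => meanCurvature κ₁ κ₂ x + gaussCurvature κ₁ κ₂ x * ⟪x, N x⟫)) := by
  have hMm := hM.measurableSet
  have hm : EqOn (meanIntegrand N P Q κ₁ κ₂ fun x => x)
      (fun x => 2 * (1 + meanCurvature κ₁ κ₂ x * ⟪x, N x⟫)) M := fun x hx => by
    simp only [meanIntegrand, fderiv_fun_id, ContinuousLinearMap.id_apply,
      real_inner_self_eq_norm_sq, hPQ.norm_P x hx, hPQ.norm_Q x hx]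
    ring
  have hg : EqOn (gaussIntegrand N P Q κ₁ κ₂ fun x => x)
      (fun x => 2 * (meanCurvature κ₁ κ₂ x + gaussCurvature κ₁ κ₂ x * ⟪x, N x⟫)) M :=
    fun x hx => by
      simp only [gaussIntegrand, fderiv_fun_id, ContinuousLinearMap.id_apply,
        real_inner_self_eq_norm_sq, hPQ.norm_P x hx, hPQ.norm_Q x hx, meanCurvature]
      ring
  have h2 : IsUnit (2 : ℝ) := isUnit_iff_ne_zero.2 two_ne_zero
  refine ⟨⟨?_, ?_⟩, ?_, ?_⟩
  · exact (integrable_const_mul_iff h2 _).1 (h.surfaceIntegrable_mean.congr_fun hm hMm)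
  · rw [h.mean, surfaceIntegral, setIntegral_congr_fun hMm hm, integral_const_mul, surfaceIntegral]
  · exact (integrable_const_mul_iff h2 _).1 (h.surfaceIntegrable_gauss.congr_fun hg hMm)
  · rw [h.gauss, surfaceIntegral, setIntegral_congr_fun hMm hg, integral_const_mul, surfaceIntegral]

end VectorIdentities

theorem mainTheorem4 (M : Set E3) (hM : IsCompact M) (hS : IsSmoothSurface M)
    (N : E3 → E3) (hN : IsUnitNormalField M N)
    (P Q : E3 → E3) (κ₁ κ₂ : E3 → ℝ) (hPQ : IsPrincipalFrame M N P Q κ₁ κ₂)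
    (H : E3 → ℝ) (hH : H = meanCurvature κ₁ κ₂)
    (K : E3 → ℝ) (hK : K = gaussCurvature κ₁ κ₂)
    (dX : E3 → E3) (hdX : dX = boundaryTangent M N)
    (dN : E3 → E3) (hdN : dN = boundaryNormalDeriv M N) :
    -- the two identities for a `C¹` vector field `V` on a neighbourhood `U` of `M`
    (∀ (U : Set E3) (V : E3 → E3), IsOpen U → M ⊆ U → ContDiffOn ℝ 1 V U →
      (BoundaryIntegrable M (fun x => ⟪V x ×ᵥ N x, dX x⟫) ∧
        SurfaceIntegrable M (fun x => ⟪fderiv ℝ V x (P x), P x⟫ + ⟪fderiv ℝ V x (Q x), Q x⟫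
          + 2 * H x * ⟪V x, N x⟫) ∧
        boundaryIntegral M (fun x => ⟪V x ×ᵥ N x, dX x⟫) =
          -surfaceIntegral M (fun x => ⟪fderiv ℝ V x (P x), P x⟫ + ⟪fderiv ℝ V x (Q x), Q x⟫
            + 2 * H x * ⟪V x, N x⟫)) ∧
      (BoundaryIntegrable M (fun x => ⟪V x ×ᵥ N x, dN x⟫) ∧
        SurfaceIntegrable M (fun x => κ₂ x * ⟪fderiv ℝ V x (P x), P x⟫
          + κ₁ x * ⟪fderiv ℝ V x (Q x), Q x⟫ + 2 * K x * ⟪V x, N x⟫) ∧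
        boundaryIntegral M (fun x => ⟪V x ×ᵥ N x, dN x⟫) =
          surfaceIntegral M (fun x => κ₂ x * ⟪fderiv ℝ V x (P x), P x⟫
            + κ₁ x * ⟪fderiv ℝ V x (Q x), Q x⟫ + 2 * K x * ⟪V x, N x⟫))) ∧
    -- the vector identities obtained from constant fields
    (BoundaryIntegrable M (fun x => N x ×ᵥ dX x) ∧
      SurfaceIntegrable M (fun x => H x • N x) ∧
      boundaryIntegral M (fun x => N x ×ᵥ dX x) =
        -((2 : ℝ) • surfaceIntegral M (fun x => H x • N x))) ∧
    (BoundaryIntegrable M (fun x => N x ×ᵥ dN x) ∧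
      SurfaceIntegrable M (fun x => K x • N x) ∧
      boundaryIntegral M (fun x => N x ×ᵥ dN x) =
        (2 : ℝ) • surfaceIntegral M (fun x => K x • N x)) ∧
    -- the vector identities obtained from rotation fields
    (BoundaryIntegrable M (fun x => x ×ᵥ (N x ×ᵥ dX x)) ∧
      SurfaceIntegrable M (fun x => H x • (x ×ᵥ N x)) ∧
      boundaryIntegral M (fun x => x ×ᵥ (N x ×ᵥ dX x)) =
        -((2 : ℝ) • surfaceIntegral M (fun x => H x • (x ×ᵥ N x)))) ∧
    (BoundaryIntegrable M (fun x => x ×ᵥ (N x ×ᵥ dN x)) ∧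
      SurfaceIntegrable M (fun x => K x • (x ×ᵥ N x)) ∧
      boundaryIntegral M (fun x => x ×ᵥ (N x ×ᵥ dN x)) =
        (2 : ℝ) • surfaceIntegral M (fun x => K x • (x ×ᵥ N x))) ∧
    -- Minkowski's formulas
    (BoundaryIntegrable M (fun x => ⟪x ×ᵥ N x, dX x⟫) ∧
      SurfaceIntegrable M (fun x => 1 + H x * ⟪x, N x⟫) ∧
      boundaryIntegral M (fun x => ⟪x ×ᵥ N x, dX x⟫) =
        -(2 * surfaceIntegral M (fun x => 1 + H x * ⟪x, N x⟫))) ∧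
    (BoundaryIntegrable M (fun x => ⟪x ×ᵥ N x, dN x⟫) ∧
      SurfaceIntegrable M (fun x => H x + K x * ⟪x, N x⟫) ∧
      boundaryIntegral M (fun x => ⟪x ×ᵥ N x, dN x⟫) =
        2 * surfaceIntegral M (fun x => H x + K x * ⟪x, N x⟫)) := by 
  subst hH hK hdX hdN
  have main := fun (U : Set E3) (V : E3 → E3) (hU : IsOpen U) (hMU : M ⊆ U)
    (hV : ContDiffOn ℝ 1 V U) => fieldIdentities_of_contDiffOn hM hS hN hPQ hU hMU hV
  have glob := fun (V : E3 → E3) (hV : ContDiff ℝ 1 V) =>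
    main univ V isOpen_univ (subset_univ M) hV.contDiffOn
  have const := FieldIdentities.vector (Z := fun e _ => e) (T := fun _ => LinearMap.id)
    (fun e => glob _ contDiff_const) (fun e x y => rfl) (fun e x y => by simp)
  have rot := FieldIdentities.vector (Z := fun e x => e ×ᵥ x)
    (T := fun x => (crossCLM x : E3 →ₗ[ℝ] E3)) (fun e => glob _ (crossCLM e).contDiff)
    (fun e x y => inner_cross_rotate e x y) (fun e x y => by
      rw [show fderiv ℝ (fun x => e ×ᵥ x) x = crossCLM e from (crossCLM e).fderiv,
        crossCLM_apply, inner_cross_right])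
  have hpos := glob (fun x => x) contDiff_id
  obtain ⟨⟨pm, pm'⟩, pg, pg'⟩ := hpos.position hM hPQ
  exact ⟨fun U V hU hMU hV =>
      have h := main U V hU hMU hV
      ⟨⟨h.boundaryIntegrable_mean, h.surfaceIntegrable_mean, h.mean⟩,
        h.boundaryIntegrable_gauss, h.surfaceIntegrable_gauss, h.gauss⟩,
    const.1, const.2, rot.1, rot.2, ⟨hpos.boundaryIntegrable_mean, pm, pm'⟩,
    hpos.boundaryIntegrable_gauss, pg, pg'⟩
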